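/- A cubical set is a presheaf on the box category $\square$ (generated by faces and degeneracies only), and it is fibrant if every map to it from an open box $\sqcap^{n}_{i,\epsilon}\subset\square^{n}$ extends to $\square^{n}$. For a vertex $x$ of a fibrant cubical set $K$, $\pi_0K$ is the set of vertices modulo the relation generated by edges, and $\pi_m(K,x)$ is the set of $m$-cubes with boundary at $x$, modulo $(m+1)$-cubes having two given cubes as opposite faces in the first direction and all other faces at $x$; for $m\ge 1$ it is a group, with $\alpha\beta=\gamma$ if some $(m+1)$-cube has $\alpha$, $\gamma$ as its faces $t_2=0$, $t_2=1$, $\beta$ as its face $t_1=1$, and all other faces at $x$. A filtered cubical set is a functor $X\colon\mathbb Z\to\{\text{cubical sets}\}$, written $\dots\to X^0\to X^1\to X^2\to\dots$; it is fibrant if every $X^k$ is. Its successor $X^\dagger$ is the cubical set whose $n$-cubes are the maps of filtered cubical sets $\mathrm{sk}(\square^n)\to X$, where $\mathrm{sk}^k(K)$ is the $k$-skeleton of $K$ (empty for $k<0$). The structure maps $X^0\to X^k$ for $k\ge 0$ determine a map $\iota\colon X^0\to X^\dagger$. If $X$ is fibrant, then so is $X^\dagger$, so that its homotopy groups are defined.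 Theorem. Let $X$ be a fibrant filtered cubical set. (1) There is a bijection $\pi_0(X^\dagger)\cong \mathrm{im}(\pi_0X^0\to\pi_0X^1)$, natural in $X$, and induced by $\iota$: it takes $\iota_*(a)$ to the image of $a$ in $\pi_0X^1$, for every $a\in\pi_0X^0$. (2) Let $x$ be a vertex of $X^0$; write $x$ also for its images in $X^\dagger$ and in $X^k$, $k\ge 0$. For every $m\ge 1$ there is an isomorphism of groups $$\pi_m(X^\dagger,x)\cong \mathrm{im}\bigl(\pi_m(X^m,x)\to\pi_m(X^{m+1},x)\bigr),$$ natural in $(X,x)$. It takes the class of $\alpha\colon\mathrm{sk}(\square^m)\to X$ to the image in $\pi_m(X^{m+1},x)$ of the class of its $m$-th component $\alpha^m\colon\square^m\to X^m$; in particular, it takes $\iota_*(a)$ to the image of $a$ in $\pi_m(X^{m+1},x)$, for every $a\in\pi_m(X^0,x)$. -/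

import Mathlib

open CategoryTheory Opposite

universe u

/-! ## The box category -/

/-- A morphism `□^m → □^n` of the box category (faces and degeneracies only; no connections, no
symmetries).  It is the map of cubes `{0,1}^m → {0,1}^n` whose `i`-th coordinate is the constant
`ε` if `coord i = .inl ε`, and the `a`-th input coordinate if `coord i = .inr a`; the input
coordinates that occur do so without repetition and in increasing order.  (Here `false` is `0` and
`true` is `1`.) -/
@[ext]
structure BoxHom (m n : ℕ) where
  coord : Fin n → Bool ⊕ Fin m
  strict : ∀ (i j : Fin n) (a b : Fin m),
    i < j → coord i = Sum.inr a → coord j = Sum.inr b → a < b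

namespace BoxHom

/-- The identity of `□^n`. -/
def id (n : ℕ) : BoxHom n n where
  coord := Sum.inr
  strict := by
    intro i j a b h h1 h2
    cases h1; cases h2; exact h

/-- Composition (in diagrammatic order): substitution of coordinates. -/
def comp {l m n : ℕ} (f : BoxHom l m) (g : BoxHom m n) : BoxHom l n where
  coord i := Sum.elim Sum.inl f.coord (g.coord i)
  strict := by
    intro i j a b h h1 h2
    cases hi : g.coord i with
    | inl e => simp [hi] at h1
    | inr a' =>
      cases hj : g.coord j with
      | inl e => simp [hj] at h2
      | inr b' =>
        simp only [hi, hj, Sum.elim_inr] at h1 h2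
        exact f.strict _ _ _ _ (g.strict _ _ _ _ h hi hj) h1 h2

theorem comp_coord {l m n : ℕ} (f : BoxHom l m) (g : BoxHom m n) (i : Fin n) :
    (f.comp g).coord i = Sum.elim Sum.inl f.coord (g.coord i) := rfl

theorem id_comp {m n : ℕ} (f : BoxHom m n) : (id m).comp f = f := by
  ext1; funext i
  rw [comp_coord]
  cases f.coord i <;> rfl

theorem comp_id {m n : ℕ} (f : BoxHom m n) : f.comp (id n) = f := rfl

theorem comp_assoc {k l m n : ℕ} (f : BoxHom k l) (g : BoxHom l m) (h : BoxHom m n) :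
    (f.comp g).comp h = f.comp (g.comp h) := by
  ext1; funext i
  simp only [comp_coord]
  cases h.coord i <;> rfl

/-- The face `□^n → □^(n+1)` inserting the constant `ε` as the `i`-th coordinate. -/
def face {n : ℕ} (i : Fin (n + 1)) (ε : Bool) : BoxHom n (n + 1) where
  coord := i.insertNth (α := fun _ => Bool ⊕ Fin n) (Sum.inl ε) Sum.inr
  strict := by
    intro j k a b h h1 h2
    induction j using i.succAboveCases with
    | x => simp at h1
    | p j =>
      induction k using i.succAboveCases with
      | x => simp at h2
      | p k =>
        simp only [Fin.insertNth_apply_succAbove, Sum.inr.injEq] at h1 h2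
        subst h1; subst h2
        exact Fin.succAbove_lt_succAbove_iff.1 h

/-- The degeneracy `□^(n+1) → □^n` forgetting the `i`-th coordinate. -/
def degen {n : ℕ} (i : Fin (n + 1)) : BoxHom (n + 1) n where
  coord j := Sum.inr (i.succAbove j)
  strict := by
    intro j k a b h h1 h2
    simp only [Sum.inr.injEq] at h1 h2
    subst h1; subst h2
    exact Fin.succAbove_lt_succAbove_iff.2 h

/-- The projection of `□^n` to the point `□^0`. -/
def toPoint (n : ℕ) : BoxHom n 0 where
  coord := Fin.elim0
  strict := fun i => i.elim0

theorem toPoint_unique {n : ℕ} (f : BoxHom n 0) : f = toPoint n := by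
  ext1; funext i; exact i.elim0

@[simp]
theorem face_coord_self {n : ℕ} (i : Fin (n + 1)) (ε : Bool) :
    (face i ε).coord i = Sum.inl ε := by
  simp [face]

@[simp]
theorem face_coord_succAbove {n : ℕ} (i : Fin (n + 1)) (ε : Bool) (j : Fin n) :
    (face i ε).coord (i.succAbove j) = Sum.inr j := by
  simp [face]

theorem comp_face_self {m n : ℕ} (f : BoxHom m n) (i : Fin (n + 1)) (ε : Bool) :
    (f.comp (face i ε)).coord i = Sum.inl ε := by
  simp [comp_coord]

theorem comp_face_succAbove {m n : ℕ} (f : BoxHom m n) (i : Fin (n + 1)) (ε : Bool) (j : Fin n) :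
    (f.comp (face i ε)).coord (i.succAbove j) = f.coord j := by
  simp [comp_coord]

theorem face_comp_degen {n : ℕ} (i : Fin (n + 1)) (ε : Bool) :
    (face i ε).comp (degen i) = id n := by
  ext1; funext j
  simp [comp_coord, degen, id]

theorem comp_face_injective {m n : ℕ} {f g : BoxHom m n} {i : Fin (n + 1)} {ε : Bool}
    (h : f.comp (face i ε) = g.comp (face i ε)) : f = g := by
  have := congrArg (fun t => t.comp (degen i)) h
  simpa only [comp_assoc, face_comp_degen, comp_id] using this

/-- A map with a constant coordinate factors through the corresponding face. -/
theorem exists_factor {m n : ℕ} (f : BoxHom m (n + 1)) (i : Fin (n + 1)) (ε : Bool)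
    (h : f.coord i = Sum.inl ε) : f = (f.comp (degen i)).comp (face i ε) := by
  ext1; funext j
  induction j using i.succAboveCases with
  | x => rw [comp_face_self, h]
  | p j => rw [comp_face_succAbove]; rfl

/-- The cubical identity between faces. -/
theorem face_comp_face {n : ℕ} (i j : Fin (n + 1)) (h : i ≤ j) (ε η : Bool) :
    (face i ε).comp (face j.succ η) = (face j η).comp (face i.castSucc ε) := by
  have h1 : j.succ.succAbove i = i.castSucc :=
    Fin.succAbove_of_castSucc_lt _ _ (by rw [Fin.lt_def]; rw [Fin.le_def] at h; simp; omega)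
  have h2 : i.castSucc.succAbove j = j.succ :=
    Fin.succAbove_of_le_castSucc _ _ (by simpa using h)
  have e1 : ((face i ε).comp (face j.succ η)).coord i.castSucc = Sum.inl ε := by
    rw [← h1, comp_face_succAbove, face_coord_self]
  rw [exists_factor _ _ _ e1]
  congr 1
  have e2 : (((face i ε).comp (face j.succ η)).comp (degen i.castSucc)).coord j = Sum.inl η := by
    show ((face i ε).comp (face j.succ η)).coord (i.castSucc.succAbove j) = _
    rw [h2, comp_face_self]
  ext1; funext k
  induction k using j.succAboveCases with
  | x => rw [e2, face_coord_self]
  | p k =>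
    rw [face_coord_succAbove]
    show ((face i ε).comp (face j.succ η)).coord (i.castSucc.succAbove (j.succAbove k)) = _
    have h3 : i.castSucc.succAbove (j.succAbove k) = j.succ.succAbove (i.succAbove k) := by
      ext
      simp only [Fin.succAbove, Fin.lt_def, Fin.le_def] at *
      split_ifs <;> simp at * <;> omega
    rw [h3, comp_face_succAbove, face_coord_succAbove]

/-- The overlap of two distinct nonparallel faces. -/
theorem exists_overlap {k n : ℕ} {i j : Fin (n + 1)} (hij : i ≤ j) {ε η : Bool}
    {a b : BoxHom k (n + 1)} (hab : a.comp (face i.castSucc ε) = b.comp (face j.succ η)) :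
    ∃ c : BoxHom k n, a = c.comp (face j η) ∧ b = c.comp (face i ε) := by
  have ea : a.coord j = Sum.inl η := by
    have := congrArg (fun t => t.coord j.succ) hab
    simp only [comp_face_self] at this
    rw [← this, ← Fin.succAbove_of_le_castSucc i.castSucc j (by simpa using hij),
      comp_face_succAbove]
  have eb : b.coord i = Sum.inl ε := by
    have := congrArg (fun t => t.coord i.castSucc) hab
    simp only [comp_face_self] at this
    rw [this, ← Fin.succAbove_of_castSucc_lt j.succ i
      (by rw [Fin.lt_def]; rw [Fin.le_def] at hij; simp; omega),
      comp_face_succAbove]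
  have fa := exists_factor a j η ea
  have fb := exists_factor b i ε eb
  generalize a.comp (degen j) = a' at fa
  generalize b.comp (degen i) = b' at fb
  subst fa; subst fb
  rw [comp_assoc, comp_assoc, face_comp_face i j hij] at hab
  rw [← comp_assoc, ← comp_assoc] at hab
  exact ⟨a', rfl, by rw [comp_face_injective (comp_face_injective hab)]⟩

theorem exists_castSucc_succ {n : ℕ} (i j : Fin (n + 2)) (hij : i < j) :
    ∃ i' j' : Fin (n + 1), i' ≤ j' ∧ i = i'.castSucc ∧ j = j'.succ := by
  rw [Fin.lt_def] at hij
  refine ⟨⟨i, by omega⟩, ⟨j - 1, by omega⟩, ?_, ?_, ?_⟩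
  · rw [Fin.le_def]; simp; omega
  · ext; simp
  · ext; simp; omega

theorem eq_of_comp_face {k n : ℕ} {i : Fin (n + 1)} {ε η : Bool} {a b : BoxHom k n}
    (hab : a.comp (face i ε) = b.comp (face i η)) : ε = η ∧ a = b := by
  have : ε = η := by
    have := congrArg (fun t => t.coord i) hab
    simpa [comp_face_self] using this
  subst this
  exact ⟨rfl, comp_face_injective hab⟩

end BoxHom

/-- The box category: objects the standard cubes `□^n`. -/
structure Box where
  dim : ℕ

instance : Category Box where
  Hom a b := BoxHom a.dim b.dim
  id a := BoxHom.id a.dim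
  comp f g := BoxHom.comp f g
  id_comp := BoxHom.id_comp
  comp_id := BoxHom.comp_id
  assoc := BoxHom.comp_assoc

/-! ## Cubical sets -/

/-- Cubical sets: presheaves on the box category. -/
abbrev CSet : Type (u + 1) := Boxᵒᵖ ⥤ Type u

namespace CSet

/-- The set `K_n` of `n`-cubes. -/
abbrev cube (K : CSet.{u}) (n : ℕ) : Type u := K.obj (op (Box.mk n))

/-- The action of `f : □^m → □^n` on cubes. -/
def res (K : CSet.{u}) {m n : ℕ} (f : BoxHom m n) (x : K.cube n) : K.cube m :=
  K.map (Quiver.Hom.op (show Box.mk m ⟶ Box.mk n from f)) x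

theorem res_res (K : CSet.{u}) {l m n : ℕ} (f : BoxHom l m) (g : BoxHom m n) (x : K.cube n) :
    K.res f (K.res g x) = K.res (f.comp g) x := by
  have := K.map_comp_apply (Quiver.Hom.op (show Box.mk m ⟶ Box.mk n from g))
    (Quiver.Hom.op (show Box.mk l ⟶ Box.mk m from f)) x
  exact this.symm

theorem res_id (K : CSet.{u}) {n : ℕ} (x : K.cube n) : K.res (BoxHom.id n) x = x :=
  K.map_id_apply (op (Box.mk n)) x

/-- The function on `n`-cubes induced by a map of cubical sets. -/
abbrev onCube {K L : CSet.{u}} (φ : K ⟶ L) {n : ℕ} (x : K.cube n) : L.cube n :=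
  φ.app (op (Box.mk n)) x

theorem onCube_res {K L : CSet.{u}} (φ : K ⟶ L) {m n : ℕ} (f : BoxHom m n) (x : K.cube n) :
    onCube φ (K.res f x) = L.res f (onCube φ x) :=
  NatTrans.naturality_apply φ _ x

/-- The standard cube `□^n`. -/
abbrev std (n : ℕ) : CSet.{u} := uliftYoneda.{u}.obj (Box.mk n)

/-- A map `□^m → □^n` as an `m`-cube of `□^n`. -/
def stdCube {m n : ℕ} (f : BoxHom m n) : cube (std.{u} n) m := ULift.up f

theorem res_stdCube {l m n : ℕ} (g : BoxHom l m) (f : BoxHom m n) :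
    res (std.{u} n) g (stdCube f) = stdCube (g.comp f) := rfl

/-- The open box (cap) `⊓^(n+1)_{i,ε} ⊆ □^(n+1)`: the union of all the faces of codimension one
other than the face `(i, ε)`. -/
def cap (n : ℕ) (i : Fin (n + 1)) (ε : Bool) : Subfunctor (std.{u} (n + 1)) where
  obj U := {h | ∃ (j : Fin (n + 1)) (η : Bool), (j, η) ≠ (i, ε) ∧
    ∃ g : BoxHom U.unop.dim n, h.down = g.comp (BoxHom.face j η)}
  map := by
    rintro U V f h ⟨j, η, hne, g, hg⟩
    refine ⟨j, η, hne, BoxHom.comp f.unop g, ?_⟩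
    show BoxHom.comp f.unop h.down = _
    rw [hg, BoxHom.comp_assoc]

/-- A cubical set is fibrant (a Kan complex) if every map from an open box to it extends to the
whole cube. -/
class IsFibrant (K : CSet.{u}) : Prop where
  exists_extension : ∀ (n : ℕ) (i : Fin (n + 1)) (ε : Bool)
    (φ : (cap.{u} n i ε).toFunctor ⟶ K), ∃ ψ : std.{u} (n + 1) ⟶ K, (cap.{u} n i ε).ι ≫ ψ = φ

/-- Fibrancy in terms of compatible families of cubes. -/
theorem isFibrant_iff (K : CSet.{u}) : K.IsFibrant ↔
    ∀ (n : ℕ) (p : Fin (n + 1) × Bool) (y : Fin (n + 1) × Bool → K.cube n),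
      (∀ q r, q ≠ p → r ≠ p → ∀ (k : ℕ) (a b : BoxHom k n),
        a.comp (BoxHom.face q.1 q.2) = b.comp (BoxHom.face r.1 r.2) →
          K.res a (y q) = K.res b (y r)) →
      ∃ z : K.cube (n + 1), ∀ q, q ≠ p → K.res (BoxHom.face q.1 q.2) z = y q := by
  constructor
  · intro hK n p y hy
    let φ : (cap.{u} n p.1 p.2).toFunctor ⟶ K :=
      { app := fun U => TypeCat.ofHom fun h =>
          K.res (m := U.unop.dim) h.2.choose_spec.choose_spec.2.choose
            (y (h.2.choose, h.2.choose_spec.choose))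
        naturality := by
          intro U V f
          ext h
          have h1 := h.2.choose_spec.choose_spec.2.choose_spec
          have h2 := (((cap.{u} n p.1 p.2).toFunctor.map f h).2).choose_spec.choose_spec.2.choose_spec
          have n1 := h.2.choose_spec.choose_spec.1
          have n2 := (((cap.{u} n p.1 p.2).toFunctor.map f h).2).choose_spec.choose_spec.1
          refine Eq.trans (hy _ (h.2.choose, h.2.choose_spec.choose) n2 n1 _ _
            (BoxHom.comp f.unop h.2.choose_spec.choose_spec.2.choose) ?_) ?_
          · refine h2.symm.trans ?_
            rw [BoxHom.comp_assoc, ← h1]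
            rfl
          · exact (K.res_res (m := U.unop.dim) (l := V.unop.dim) f.unop _ _).symm }
    obtain ⟨ψ, hψ⟩ := hK.exists_extension n p.1 p.2 φ
    refine ⟨onCube ψ (stdCube (BoxHom.id (n + 1))), fun q hq => ?_⟩
    rw [← onCube_res, res_stdCube, BoxHom.comp_id]
    let h : cube (cap.{u} n p.1 p.2).toFunctor n :=
      ⟨stdCube (BoxHom.face q.1 q.2), q.1, q.2, hq, BoxHom.id n, (BoxHom.id_comp _).symm⟩
    have e : onCube ψ (stdCube (BoxHom.face q.1 q.2)) = onCube φ h := by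
      rw [← hψ]; rfl
    refine e.trans ?_
    have h1 := h.2.choose_spec.choose_spec.2.choose_spec
    have n1 := h.2.choose_spec.choose_spec.1
    refine Eq.trans (hy _ q n1 hq n _ (BoxHom.id n) ?_) (K.res_id _)
    exact h1.symm.trans (BoxHom.id_comp _).symm
  · intro H
    refine ⟨fun n i ε φ => ?_⟩
    let pt : ∀ q : Fin (n + 1) × Bool, q ≠ (i, ε) → cube (cap.{u} n i ε).toFunctor n := fun q hq =>
      ⟨ULift.up (BoxHom.face q.1 q.2), q.1, q.2, hq, BoxHom.id n, (BoxHom.id_comp _).symm⟩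
    have hn : Nonempty (K.cube n) :=
      ⟨onCube φ (pt (i, !ε) (by simp))⟩
    classical
    obtain ⟨z, hz⟩ := H n (i, ε)
      (fun q => if hq : q ≠ (i, ε) then onCube φ (pt q hq) else hn.some) (by
        intro q r hq hr k a b hab
        simp only [dif_pos hq, dif_pos hr]
        rw [← onCube_res, ← onCube_res]
        congr 1
        exact Subtype.ext (congrArg ULift.up hab))
    refine ⟨uliftYonedaEquiv.symm z, ?_⟩
    ext U h
    obtain ⟨h, j, η, hne, g, hg⟩ := h
    have e : (⟨h, j, η, hne, g, hg⟩ : (cap.{u} n i ε).toFunctor.obj U) =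
        res (cap.{u} n i ε).toFunctor (m := U.unop.dim) g (pt (j, η) hne) :=
      Subtype.ext (ULift.ext _ _ hg)
    rw [e]
    refine Eq.trans ?_ (onCube_res φ g _).symm
    have hz' := hz (j, η) hne
    rw [dif_pos hne] at hz'
    rw [← hz', res_res]
    rfl


/-- In a fibrant cubical set, all but one of the faces of an `(n+2)`-cube can be prescribed, with
prescribed compatible boundaries `spec`; the remaining face then has its prescribed boundary. -/
theorem IsFibrant.exists_lid (K : CSet.{u}) [hK : K.IsFibrant] {n : ℕ}
    (spec : Fin (n + 2) → Bool → Fin (n + 1) → Bool → K.cube n)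
    (hspec : ∀ (i j : Fin (n + 1)), i ≤ j → ∀ ε η, spec i.castSucc ε j η = spec j.succ η i ε)
    (p : Fin (n + 2) × Bool) (y : Fin (n + 2) → Bool → K.cube (n + 1))
    (hy : ∀ i ε, (i, ε) ≠ p → ∀ j η, K.res (BoxHom.face j η) (y i ε) = spec i ε j η) :
    ∃ z : K.cube (n + 2), (∀ i ε, (i, ε) ≠ p → K.res (BoxHom.face i ε) z = y i ε) ∧
      ∀ j η, K.res (BoxHom.face j η) (K.res (BoxHom.face p.1 p.2) z) = spec p.1 p.2 j η := by
  -- two faces with different indices overlap compatibly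
  have key : ∀ (i j : Fin (n + 1)), i ≤ j → ∀ ε η, (i.castSucc, ε) ≠ p → (j.succ, η) ≠ p →
      ∀ (k : ℕ) (a b : BoxHom k (n + 1)),
      a.comp (BoxHom.face i.castSucc ε) = b.comp (BoxHom.face j.succ η) →
      K.res a (y i.castSucc ε) = K.res b (y j.succ η) := by
    intro i j hij ε η h1 h2 k a b hab
    obtain ⟨c, rfl, rfl⟩ := BoxHom.exists_overlap hij hab
    rw [← res_res, ← res_res, hy _ _ h1, hy _ _ h2, hspec i j hij]
  obtain ⟨z, hz⟩ := (isFibrant_iff K).1 hK (n + 1) p (fun q => y q.1 q.2) (by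
    rintro ⟨i, ε⟩ ⟨j, η⟩ h1 h2 k a b hab
    simp only at hab ⊢
    rcases lt_trichotomy i j with h | h | h
    · obtain ⟨i', j', hle, rfl, rfl⟩ := BoxHom.exists_castSucc_succ i j h
      exact key i' j' hle ε η h1 h2 k a b hab
    · subst h
      obtain ⟨rfl, rfl⟩ := BoxHom.eq_of_comp_face hab
      rfl
    · obtain ⟨i', j', hle, rfl, rfl⟩ := BoxHom.exists_castSucc_succ j i h
      exact (key i' j' hle η ε h2 h1 k b a hab.symm).symm)
  refine ⟨z, fun i ε h => hz (i, ε) h, fun j η => ?_⟩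
  obtain ⟨p, δ⟩ := p
  simp only
  rw [res_res]
  rcases lt_or_ge j.castSucc p with h | h
  · obtain ⟨i', j', hle, e1, rfl⟩ := BoxHom.exists_castSucc_succ _ p h
    obtain rfl : j = i' := Fin.castSucc_injective _ e1
    have hne : (j.castSucc, η) ≠ (j'.succ, δ) := by
      intro e; rw [Prod.mk.injEq] at e; rw [e.1] at h; exact lt_irrefl _ h
    rw [BoxHom.face_comp_face j j' hle, ← res_res, hz _ hne, hy _ _ hne, hspec j j' hle]
  · have hp : p < j.succ := lt_of_le_of_lt h (by rw [Fin.lt_def]; simp)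
    obtain ⟨i', j', hle, rfl, e1⟩ := BoxHom.exists_castSucc_succ p _ hp
    obtain rfl : j = j' := Fin.succ_injective _ e1
    have hne : (j.succ, η) ≠ (i'.castSucc, δ) := by
      intro e; rw [Prod.mk.injEq] at e; rw [e.1] at hp; exact lt_irrefl _ hp
    rw [← BoxHom.face_comp_face i' j hle, ← res_res, hz _ hne, hy _ _ hne, hspec i' j hle]

/-! ## Homotopy groups -/

/-- The set `π₀ K`: vertices modulo the equivalence relation generated by the edges. -/
def PiZero (K : CSet.{u}) : Type u :=
  Quot fun a b : K.cube 0 => ∃ e : K.cube 1,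
    K.res (BoxHom.face 0 false) e = a ∧ K.res (BoxHom.face 0 true) e = b

/-- The map induced on `π₀`. -/
def PiZero.map {K L : CSet.{u}} (φ : K ⟶ L) : PiZero K → PiZero L :=
  Quot.map (fun a => onCube φ a) (by
    rintro a b ⟨e, rfl, rfl⟩
    exact ⟨onCube φ e, (onCube_res φ _ e).symm, (onCube_res φ _ e).symm⟩)

/-- The degenerate `n`-cube at a vertex. -/
def const (K : CSet.{u}) (x : K.cube 0) (n : ℕ) : K.cube n := K.res (BoxHom.toPoint n) x

theorem res_const (K : CSet.{u}) (x : K.cube 0) {m n : ℕ} (f : BoxHom m n) :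
    K.res f (K.const x n) = K.const x m := by
  rw [const, res_res, BoxHom.toPoint_unique (f.comp _)]; rfl

theorem onCube_const {K L : CSet.{u}} (φ : K ⟶ L) (x : K.cube 0) (n : ℕ) :
    onCube φ (K.const x n) = L.const (onCube φ x) n := onCube_res φ _ x

/-- The `n`-cubes of `K` all of whose boundary is at the basepoint `x`.  The boundary of `□^n`
consists of the maps to `□^n` having a constant coordinate, i.e. factoring through a face. -/
def Sphere (K : CSet.{u}) (x : K.cube 0) (n : ℕ) : Type u :=
  { a : K.cube n // ∀ (m : ℕ) (f : BoxHom m n), (∃ i ε, f.coord i = Sum.inl ε) →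
      K.res f a = K.const x m }

namespace Sphere

/-- The constant sphere. -/
def one (K : CSet.{u}) (x : K.cube 0) (n : ℕ) : K.Sphere x n :=
  ⟨K.const x n, fun _ f _ => K.res_const x f⟩

/-- For `n ≥ 1`, a sphere is an `n`-cube all of whose faces are at the basepoint. -/
theorem isSphere_iff {K : CSet.{u}} {x : K.cube 0} {n : ℕ} (a : K.cube (n + 1)) :
    (∀ (m : ℕ) (f : BoxHom m (n + 1)), (∃ i ε, f.coord i = Sum.inl ε) →
      K.res f a = K.const x m) ↔
    ∀ i ε, K.res (BoxHom.face i ε) a = K.const x n := by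
  constructor
  · intro h i ε
    exact h n _ ⟨i, ε, BoxHom.face_coord_self i ε⟩
  · rintro h m f ⟨i, ε, hf⟩
    rw [BoxHom.exists_factor f i ε hf, ← res_res, h, res_const]

theorem res_face {K : CSet.{u}} {x : K.cube 0} {n : ℕ} (a : K.Sphere x (n + 1)) (i : Fin (n + 1))
    (ε : Bool) : K.res (BoxHom.face i ε) a.1 = K.const x n :=
  (isSphere_iff a.1).1 a.2 i ε

/-- The image of a sphere under a map of pointed cubical sets. -/
def map {K L : CSet.{u}} (φ : K ⟶ L) {x : K.cube 0} {y : L.cube 0} (h : onCube φ x = y) {n : ℕ}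
    (a : K.Sphere x n) : L.Sphere y n :=
  ⟨onCube φ a.1, fun m f hf => by rw [← onCube_res, a.2 m f hf, onCube_const, h]⟩

/-- Two spheres `a`, `b` are homotopic if there is an `(n+1)`-cube whose first face is `a`, whose
opposite face is `b`, and all of whose other faces are at the basepoint. -/
def Homotopic {K : CSet.{u}} {x : K.cube 0} {n : ℕ} (a b : K.Sphere x n) : Prop :=
  ∃ H : K.cube (n + 1), K.res (BoxHom.face 0 false) H = a.1 ∧ K.res (BoxHom.face 0 true) H = b.1 ∧
    ∀ (i : Fin (n + 1)) (ε : Bool), i ≠ 0 → K.res (BoxHom.face i ε) H = K.const x n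

end Sphere

/-- The homotopy set `π_n(K, x)`: spheres up to homotopy.  (For a fibrant cubical set being
homotopic is an equivalence relation.) -/
def PiN (n : ℕ) (K : CSet.{u}) (x : K.cube 0) : Type u :=
  Quot (Sphere.Homotopic (K := K) (x := x) (n := n))

/-- The homotopy class of a sphere. -/
def PiN.mk {n : ℕ} {K : CSet.{u}} {x : K.cube 0} (a : K.Sphere x n) : PiN n K x := Quot.mk _ a

/-- The map induced on `π_n` by a map of pointed cubical sets. -/
def PiN.map {n : ℕ} {K L : CSet.{u}} (φ : K ⟶ L) {x : K.cube 0} {y : L.cube 0}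
    (h : onCube φ x = y) : PiN n K x → PiN n L y :=
  Quot.map (Sphere.map φ h) (by
    rintro a b ⟨H, h1, h2, h3⟩
    refine ⟨onCube φ H, ?_, ?_, fun i ε hi => ?_⟩
    · rw [← onCube_res, h1]; rfl
    · rw [← onCube_res, h2]; rfl
    · rw [← onCube_res, h3 i ε hi, onCube_const, h])

/-- The prescribed faces of an `(n+2)`-cube with faces `bot` (second coordinate `0`),
`top` (second coordinate `1`), `left` (first coordinate `0`), `right` (first coordinate `1`), the
remaining ones being at the basepoint. -/
def bdry {K : CSet.{u}} {x : K.cube 0} {n : ℕ} (bot top left right : K.Sphere x (n + 1))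
    (i : Fin (n + 2)) (ε : Bool) : K.cube (n + 1) :=
  Fin.cases (if ε then right.1 else left.1)
    (Fin.cases (if ε then top.1 else bot.1) (fun _ => K.const x (n + 1))) i

/-- There is an `(n+2)`-cube with the given faces: this is the relation
`bot · right = left · top` in `π_{n+1}`. -/
def Sq {K : CSet.{u}} {x : K.cube 0} {n : ℕ} (bot top left right : K.Sphere x (n + 1)) : Prop :=
  ∃ σ : K.cube (n + 2), ∀ i ε, K.res (BoxHom.face i ε) σ = bdry bot top left right i ε

section Sq

variable {K : CSet.{u}} {x : K.cube 0} {n : ℕ}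

theorem res_bdry (a b c d : K.Sphere x (n + 1)) (i : Fin (n + 2)) (ε : Bool) (j : Fin (n + 1))
    (η : Bool) : K.res (BoxHom.face j η) (bdry a b c d i ε) = K.const x n := by
  induction i using Fin.cases with
  | zero => cases ε; exacts [c.res_face j η, d.res_face j η]
  | succ i =>
    induction i using Fin.cases with
    | zero => cases ε; exacts [a.res_face j η, b.res_face j η]
    | succ i => exact res_const _ _ _

theorem homotopic_iff_sq (a b : K.Sphere x (n + 1)) :
    a.Homotopic b ↔ Sq (Sphere.one K x _) (Sphere.one K x _) a b := by
  constructor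
  · rintro ⟨H, h1, h2, h3⟩
    refine ⟨H, fun i ε => ?_⟩
    induction i using Fin.cases with
    | zero => cases ε <;> assumption
    | succ i =>
      rw [h3 _ _ (Fin.succ_ne_zero i)]
      induction i using Fin.cases with
      | zero => cases ε <;> rfl
      | succ i => rfl
  · rintro ⟨H, h⟩
    refine ⟨H, h 0 false, h 0 true, fun i ε hi => ?_⟩
    rw [h]
    induction i using Fin.cases with
    | zero => exact absurd rfl hi
    | succ i =>
      induction i using Fin.cases with
      | zero => cases ε <;> rfl
      | succ i => rfl

theorem Sq.map {L : CSet.{u}} {y : L.cube 0} (φ : K ⟶ L) (h : onCube φ x = y)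
    {a b c d : K.Sphere x (n + 1)} (H : Sq a b c d) :
    Sq (a.map φ h) (b.map φ h) (c.map φ h) (d.map φ h) := by
  obtain ⟨σ, hσ⟩ := H
  refine ⟨onCube φ σ, fun i ε => ?_⟩
  rw [← onCube_res, hσ]
  induction i using Fin.cases with
  | zero => cases ε <;> rfl
  | succ i =>
    induction i using Fin.cases with
    | zero => cases ε <;> rfl
    | succ i => exact (onCube_const φ x _).trans (by rw [h]; rfl)

/-- Degenerate squares. -/
theorem sq_degen (i : Fin 2) (a : K.Sphere x (n + 1)) :
    if i = 0 then Sq (Sphere.one K x _) (Sphere.one K x _) a a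
    else Sq a a (Sphere.one K x _) (Sphere.one K x _) := by
  have const_face : ∀ (i j : Fin (n + 2)) (ε : Bool), i ≠ j →
      K.res (BoxHom.face i ε) (K.res (BoxHom.degen j) a.1) = K.const x (n + 1) := by
    intro i j ε hij
    rw [res_res]
    obtain ⟨k, hk⟩ := Fin.exists_succAbove_eq hij
    refine a.2 _ _ ⟨k, ε, ?_⟩
    show (BoxHom.face i ε).coord (j.succAbove k) = _
    rw [hk, BoxHom.face_coord_self]
  have self_face : ∀ (j : Fin (n + 2)) (ε : Bool),
      K.res (BoxHom.face j ε) (K.res (BoxHom.degen j) a.1) = a.1 := by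
    intro j ε
    rw [res_res, BoxHom.face_comp_degen, res_id]
  split_ifs with h
  · refine ⟨K.res (BoxHom.degen 0) a.1, fun j ε => ?_⟩
    induction j using Fin.cases with
    | zero => rw [self_face]; cases ε <;> rfl
    | succ j =>
      rw [const_face _ _ _ (Fin.succ_ne_zero j)]
      induction j using Fin.cases with
      | zero => cases ε <;> rfl
      | succ i => rfl
  · refine ⟨K.res (BoxHom.degen (Fin.succ 0)) a.1, fun j ε => ?_⟩
    induction j using Fin.cases with
    | zero => rw [const_face _ _ _ (Fin.succ_ne_zero 0).symm]; cases ε <;> rfl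
    | succ j =>
      induction j using Fin.cases with
      | zero => rw [self_face]; cases ε <;> rfl
      | succ j =>
        rw [const_face _ _ _ (by simp [Fin.ext_iff])]; rfl

theorem sq_refl (a : K.Sphere x (n + 1)) : Sq (Sphere.one K x _) (Sphere.one K x _) a a :=
  sq_degen 0 a

theorem sq_refl' (a : K.Sphere x (n + 1)) : Sq a a (Sphere.one K x _) (Sphere.one K x _) :=
  sq_degen 1 a

theorem Sphere.Homotopic.refl (a : K.Sphere x (n + 1)) : a.Homotopic a :=
  (homotopic_iff_sq _ _).2 (sq_refl a)

/-- Any three of the faces of a square extend to a square. -/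
theorem exists_sq_lid [K.IsFibrant] (p : Fin (n + 2) × Bool) (a b c d : K.Sphere x (n + 1)) :
    ∃ (e : K.Sphere x (n + 1)) (σ : K.cube (n + 2)), K.res (BoxHom.face p.1 p.2) σ = e.1 ∧
      ∀ i ε, (i, ε) ≠ p → K.res (BoxHom.face i ε) σ = bdry a b c d i ε := by
  obtain ⟨z, h1, h2⟩ := IsFibrant.exists_lid K (fun _ _ _ _ => K.const x n)
    (fun _ _ _ _ _ => rfl) p (bdry a b c d) (fun i ε _ j η => res_bdry a b c d i ε j η)
  exact ⟨⟨_, (Sphere.isSphere_iff _).2 h2⟩, z, rfl, h1⟩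

theorem exists_sq_top [K.IsFibrant] (a c d : K.Sphere x (n + 1)) : ∃ b, Sq a b c d := by
  obtain ⟨b, σ, h1, h2⟩ := exists_sq_lid (Fin.succ 0, true) a a c d
  refine ⟨b, σ, fun i ε => ?_⟩
  by_cases h : (i, ε) = (Fin.succ 0, true)
  · obtain ⟨rfl, rfl⟩ := Prod.mk.inj h
    exact h1
  · rw [h2 i ε h]
    induction i using Fin.cases with
    | zero => rfl
    | succ i =>
      induction i using Fin.cases with
      | zero => cases ε
                · rfl
                · exact absurd rfl h
      | succ i => rfl

theorem exists_sq_right [K.IsFibrant] (a b c : K.Sphere x (n + 1)) : ∃ d, Sq a b c d := by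
  obtain ⟨d, σ, h1, h2⟩ := exists_sq_lid (0, true) a b c c
  refine ⟨d, σ, fun i ε => ?_⟩
  by_cases h : (i, ε) = (0, true)
  · obtain ⟨rfl, rfl⟩ := Prod.mk.inj h
    exact h1
  · rw [h2 i ε h]
    induction i using Fin.cases with
    | zero => cases ε
              · rfl
              · exact absurd rfl h
    | succ i => rfl

/-- The six squares on the boundary of a three-dimensional cube with edges `X t u`, `Y s u`,
`Z s t`. -/
def CubeFace (X Y Z : Bool → Bool → K.Sphere x (n + 1)) (i : Fin 3) (ε : Bool) : Prop :=
  match i with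
  | 0 => Sq (Y ε false) (Y ε true) (Z ε false) (Z ε true)
  | 1 => Sq (X ε false) (X ε true) (Z false ε) (Z true ε)
  | 2 => Sq (X false ε) (X true ε) (Y false ε) (Y true ε)

/-- The prescribed boundaries of the faces of an `(n+3)`-cube. -/
def cubeSpec (X Y Z : Bool → Bool → K.Sphere x (n + 1)) (i : Fin (n + 3)) (ε : Bool) :
    Fin (n + 2) → Bool → K.cube (n + 1) :=
  Fin.cases (bdry (Y ε false) (Y ε true) (Z ε false) (Z ε true))
    (Fin.cases (bdry (X ε false) (X ε true) (Z false ε) (Z true ε))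
      (Fin.cases (bdry (X false ε) (X true ε) (Y false ε) (Y true ε))
        (fun _ _ _ => K.const x (n + 1)))) i

theorem cubeSpec_compat (X Y Z : Bool → Bool → K.Sphere x (n + 1)) (i j : Fin (n + 2))
    (h : i ≤ j) (ε η : Bool) :
    cubeSpec X Y Z i.castSucc ε j η = cubeSpec X Y Z j.succ η i ε := by
  induction i using Fin.cases with
  | zero =>
    induction j using Fin.cases with
    | zero => cases ε <;> cases η <;> rfl
    | succ j =>
      induction j using Fin.cases with
      | zero => cases ε <;> cases η <;> rfl
      | succ j => rfl
  | succ i =>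
    induction j using Fin.cases with
    | zero => exact absurd h (by simp)
    | succ j =>
      induction i using Fin.cases with
      | zero =>
        induction j using Fin.cases with
        | zero => cases ε <;> cases η <;> rfl
        | succ j => rfl
      | succ i =>
        induction j using Fin.cases with
        | zero => exact absurd h (by simp [Fin.le_def])
        | succ j =>
          cases n with
          | zero => exact i.elim0
          | succ n =>
            induction i using Fin.cases with
            | zero => rfl
            | succ i => rfl

/-- If five of the six faces of a three-dimensional cube can be filled, so can the sixth. -/
theorem cubeFace_of_others [K.IsFibrant] (X Y Z : Bool → Bool → K.Sphere x (n + 1))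
    (p : Fin 3 × Bool) (H : ∀ i ε, (i, ε) ≠ p → CubeFace X Y Z i ε) :
    CubeFace X Y Z p.1 p.2 := by
  have e3 : ∀ (i : Fin 3) (ε : Bool), CubeFace X Y Z i ε ↔
      ∃ σ : K.cube (n + 2), ∀ j η, K.res (BoxHom.face j η) σ =
        cubeSpec X Y Z (Fin.castLE (by omega) i) ε j η := by
    intro i ε
    fin_cases i <;> rfl
  have H' : ∀ (i : Fin (n + 3)) (ε : Bool), ∃ σ : K.cube (n + 2),
      (i, ε) ≠ (Fin.castLE (by omega) p.1, p.2) →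
        ∀ j η, K.res (BoxHom.face j η) σ = cubeSpec X Y Z i ε j η := by
    intro i ε
    by_cases hp : (i, ε) = (Fin.castLE (by omega) p.1, p.2)
    · exact ⟨K.const x _, fun h => absurd hp h⟩
    by_cases hi : (i : ℕ) < 3
    · obtain ⟨σ, hσ⟩ := (e3 ⟨i, hi⟩ ε).1 (H _ _ (by
        rintro rfl
        exact hp rfl))
      exact ⟨σ, fun _ => hσ⟩
    · refine ⟨K.const x _, fun _ j η => ?_⟩
      rw [res_const]
      obtain ⟨k, rfl⟩ : ∃ k : Fin n, i = k.succ.succ.succ :=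
        ⟨⟨i - 3, by omega⟩, by ext; simp; omega⟩
      rfl
  choose y hy using H'
  obtain ⟨z, -, hz⟩ := IsFibrant.exists_lid K (cubeSpec X Y Z) (cubeSpec_compat X Y Z)
    (Fin.castLE (by omega) p.1, p.2) y (fun i ε h => hy i ε h)
  exact (e3 _ _).2 ⟨_, hz⟩

end Sq

/-! ### The group structure -/

section Group

variable {K : CSet.{u}} [K.IsFibrant] {x : K.cube 0} {n : ℕ}

/-- The right faces of two squares with homotopic remaining faces are homotopic, and likewise for
the top faces. -/
theorem sq_congr (p : Fin 2) {a a' b b' c c' d d' : K.Sphere x (n + 1)} (h : Sq a b c d)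
    (h' : Sq a' b' c' d') (ha : a.Homotopic a') (hb : p ≠ 0 → b.Homotopic b')
    (hc : c.Homotopic c') (hd : p = 0 → d.Homotopic d') :
    if p = 0 then b.Homotopic b' else d.Homotopic d' := by
  simp only [homotopic_iff_sq] at *
  let X : Bool → Bool → K.Sphere x (n + 1) := fun _ _ => Sphere.one K x _
  let Y : Bool → Bool → K.Sphere x (n + 1) := fun s u =>
    if s then (if u then b' else a') else (if u then b else a)
  let Z : Bool → Bool → K.Sphere x (n + 1) := fun s t =>
    if s then (if t then d' else c') else (if t then d else c)
  split_ifs with hp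
  · refine cubeFace_of_others X Y Z (2, true) fun i ε hi => ?_
    fin_cases i <;> cases ε
    · exact h
    · exact h'
    · exact hc
    · exact hd hp
    · exact ha
    · exact absurd rfl hi
  · refine cubeFace_of_others X Y Z (1, true) fun i ε hi => ?_
    fin_cases i <;> cases ε
    · exact h
    · exact h'
    · exact hc
    · exact absurd rfl hi
    · exact ha
    · exact hb hp

/-- The product of two spheres: a chosen top face of a square with bottom face `a`, right face `b`
and left face at the basepoint. -/
noncomputable def Sphere.mul (a b : K.Sphere x (n + 1)) : K.Sphere x (n + 1) :=
  (exists_sq_top a (Sphere.one K x _) b).choose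

theorem Sphere.mul_sq (a b : K.Sphere x (n + 1)) :
    Sq a (a.mul b) (Sphere.one K x _) b :=
  (exists_sq_top a (Sphere.one K x _) b).choose_spec

theorem Sphere.mul_congr {a a' b b' : K.Sphere x (n + 1)} (ha : a.Homotopic a')
    (hb : b.Homotopic b') : (a.mul b).Homotopic (a'.mul b') :=
  sq_congr 0 (Sphere.mul_sq a b) (Sphere.mul_sq a' b') ha (fun h => absurd rfl h)
    (Sphere.Homotopic.refl _) (fun _ => hb)

/-- The product on `π_{n+1}(K, x)` for fibrant `K`, characterised by: `α · β = γ` if there is an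
`(n+2)`-cube having `α`, `β`, `γ` as appropriately oriented faces, the remaining faces being at the
basepoint. -/
noncomputable instance : Mul (PiN (n + 1) K x) where
  mul := Quot.map₂ Sphere.mul
    (fun a _ _ h => Sphere.mul_congr (Sphere.Homotopic.refl a) h)
    (fun _ _ b h => Sphere.mul_congr h (Sphere.Homotopic.refl b))

noncomputable instance : One (PiN (n + 1) K x) where
  one := PiN.mk (Sphere.one K x _)

theorem PiN.mul_eq_of_sq {a b c : K.Sphere x (n + 1)} (h : Sq a c (Sphere.one K x _) b) :
    PiN.mk a * PiN.mk b = PiN.mk c :=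
  Quot.sound (sq_congr 0 (Sphere.mul_sq a b) h (Sphere.Homotopic.refl _) (fun h => absurd rfl h)
    (Sphere.Homotopic.refl _) (fun _ => Sphere.Homotopic.refl _))

theorem PiN.exists_right_inverse (a : PiN (n + 1) K x) : ∃ b, a * b = 1 := by
  induction a using Quot.ind with
  | mk a =>
    obtain ⟨b, hb⟩ := exists_sq_right a (Sphere.one K x _) (Sphere.one K x _)
    exact ⟨PiN.mk b, PiN.mul_eq_of_sq hb⟩

noncomputable instance : Inv (PiN (n + 1) K x) where
  inv a := (PiN.exists_right_inverse a).choose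

theorem PiN.mul_assoc' (a b c : PiN (n + 1) K x) : a * b * c = a * (b * c) := by
  induction a using Quot.ind with
  | mk a =>
  induction b using Quot.ind with
  | mk b =>
  induction c using Quot.ind with
  | mk c =>
    let o := Sphere.one K x (n + 1)
    let X : Bool → Bool → K.Sphere x (n + 1) := fun t u =>
      if t then (if u then (a.mul b).mul c else a.mul b) else a
    let Y : Bool → Bool → K.Sphere x (n + 1) := fun s u =>
      if s then (if u then b.mul c else b) else o
    let Z : Bool → Bool → K.Sphere x (n + 1) := fun s t => if s then (if t then c else o) else o
    have key : CubeFace X Y Z 2 true := by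
      refine cubeFace_of_others X Y Z (2, true) fun i ε hi => ?_
      fin_cases i <;> cases ε
      · exact sq_refl o
      · exact Sphere.mul_sq b c
      · exact sq_refl' a
      · exact Sphere.mul_sq (a.mul b) c
      · exact Sphere.mul_sq a b
      · exact absurd rfl hi
    exact (PiN.mul_eq_of_sq (b := b.mul c) key).symm

/-- For fibrant `K` the homotopy set `π_{n+1}(K, x)` is a group. -/
noncomputable instance : Group (PiN (n + 1) K x) :=
  Group.ofRightAxioms PiN.mul_assoc'
    (fun a => by
      induction a using Quot.ind with
      | mk a => exact PiN.mul_eq_of_sq (sq_refl' a))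
    (fun a => (PiN.exists_right_inverse a).choose_spec)

/-- The group homomorphism induced on `π_{n+1}` by a map of pointed fibrant cubical sets. -/
noncomputable def PiN.mapHom {L : CSet.{u}} [L.IsFibrant] (φ : K ⟶ L) {y : L.cube 0}
    (h : onCube φ x = y) : PiN (n + 1) K x →* PiN (n + 1) L y :=
  MonoidHom.mk' (PiN.map φ h) (by
    intro a b
    induction a using Quot.ind with
    | mk a =>
    induction b using Quot.ind with
    | mk b =>
      refine Eq.symm (PiN.mul_eq_of_sq (a := a.map φ h) (b := b.map φ h) (c := (a.mul b).map φ h) ?_)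
      have := (Sphere.mul_sq a b).map φ h
      have e : (Sphere.one K x (n + 1)).map φ h = Sphere.one L y (n + 1) :=
        Subtype.ext ((onCube_const φ x _).trans (by rw [h]; rfl))
      rwa [e] at this)

end Group

end CSet

/-! ## Skeleta, filtered cubical sets and the successor -/

namespace CSet

/-- The `k`-skeleton of a cubical set (`k` an integer): the cubes that are obtained by restriction
from a cube of dimension at most `k`.  It is empty for `k < 0`. -/
def skeleton (K : CSet.{u}) (k : ℤ) : Subfunctor K where
  obj U := {x | ∃ (m : ℕ) (_ : (m : ℤ) ≤ k) (f : U.unop ⟶ Box.mk m) (y : K.cube m),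
    K.map f.op y = x}
  map := by
    rintro U V g x ⟨m, hm, f, y, rfl⟩
    exact ⟨m, hm, g.unop ≫ f, y, (K.map_comp_apply f.op g y)⟩

theorem skeleton_mono (K : CSet.{u}) {k l : ℤ} (h : k ≤ l) : K.skeleton k ≤ K.skeleton l := by
  rintro U x ⟨m, hm, f, y, e⟩
  exact ⟨m, hm.trans h, f, y, e⟩

theorem mem_skeleton_map {K L : CSet.{u}} (φ : K ⟶ L) {k : ℤ} {U : Boxᵒᵖ} {x : K.obj U}
    (h : x ∈ (K.skeleton k).obj U) : φ.app U x ∈ (L.skeleton k).obj U := by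
  obtain ⟨m, hm, f, y, rfl⟩ := h
  exact ⟨m, hm, f, φ.app _ y, (NatTrans.naturality_apply φ f.op y).symm⟩

/-- The map induced on `k`-skeleta. -/
def skeletonMap {K L : CSet.{u}} (φ : K ⟶ L) (k : ℤ) :
    (K.skeleton k).toFunctor ⟶ (L.skeleton k).toFunctor where
  app U := TypeCat.ofHom fun x => ⟨φ.app U x.1, mem_skeleton_map φ x.2⟩
  naturality := by
    intro U V f
    ext x
    have := NatTrans.naturality_apply φ f x.1
    exact Subtype.ext this

end CSet

/-- Filtered cubical sets: functors from the poset of integers to cubical sets. -/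
abbrev FilCSet : Type (u + 1) := ℤ ⥤ CSet.{u}

namespace FilCSet

open CSet

/-- The skeletal filtration, as a functor from cubical sets to filtered cubical sets. -/
def sk : CSet.{u} ⥤ FilCSet.{u} where
  obj K :=
    { obj := fun k => (K.skeleton k).toFunctor
      map := fun f => Subfunctor.homOfLe (K.skeleton_mono (leOfHom f)) }
  map φ := { app := skeletonMap φ }

/-- The successor `X^†` of a filtered cubical set, whose `n`-cubes are the maps of filtered cubical
sets from the skeletal filtration of `□^n` to `X`. -/
noncomputable def dagger (X : FilCSet.{u}) : CSet.{u} :=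
  (uliftYoneda.{u} ⋙ sk.{u}).op ⋙ yoneda.obj X

/-- Functoriality of the successor. -/
noncomputable def daggerMap {X Y : FilCSet.{u}} (f : X ⟶ Y) : dagger X ⟶ dagger Y :=
  Functor.whiskerLeft (uliftYoneda.{u} ⋙ sk.{u}).op (yoneda.map f)

/-- The structure map `X^k → X^l` for `k ≤ l`. -/
noncomputable abbrev trans (X : FilCSet.{u}) {k l : ℤ} (h : k ≤ l) : X.obj k ⟶ X.obj l := X.map (homOfLE h)

theorem trans_trans (X : FilCSet.{u}) {k l m : ℤ} (h : k ≤ l) (h' : l ≤ m) {U : Boxᵒᵖ}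
    (x : (X.obj k).obj U) :
    (trans X h').app U ((trans X h).app U x) = (trans X (h.trans h')).app U x := by
  have : trans X (h.trans h') = trans X h ≫ trans X h' := by
    rw [trans, trans, trans, ← X.map_comp]; rfl
  rw [this]; rfl

theorem trans_self (X : FilCSet.{u}) {k : ℤ} (h : k ≤ k) {U : Boxᵒᵖ} (x : (X.obj k).obj U) :
    (trans X h).app U x = x := by
  have : trans X h = 𝟙 _ := X.map_id k
  rw [this]; rfl

/-- A map to `□^n` lies in the `k`-skeleton. -/
def InSk {m n : ℕ} (k : ℤ) (f : BoxHom m n) : Prop :=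
  ∃ (l : ℕ) (_ : (l : ℤ) ≤ k) (g : BoxHom m l) (h : BoxHom l n), g.comp h = f

theorem mem_skeleton_std {m n : ℕ} {k : ℤ} (f : BoxHom m n) (h : InSk k f) :
    stdCube f ∈ ((std.{u} n).skeleton k).obj (op (Box.mk m)) := by
  obtain ⟨l, hl, g, h, rfl⟩ := h
  exact ⟨l, hl, g, stdCube h, rfl⟩

theorem inSk_of_mem {m n : ℕ} {k : ℤ} {f : (std.{u} n).cube m}
    (h : f ∈ ((std.{u} n).skeleton k).obj (op (Box.mk m))) : InSk (m := m) k f.down := by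
  obtain ⟨l, hl, g, h, rfl⟩ := h
  exact ⟨l, hl, g, h.down, rfl⟩

theorem InSk.nonneg {m n : ℕ} {k : ℤ} {f : BoxHom m n} (h : InSk k f) : 0 ≤ k := by
  obtain ⟨l, hl, -⟩ := h
  omega

theorem InSk.comp_left {l m n : ℕ} {k : ℤ} {f : BoxHom m n} (h : InSk k f) (g : BoxHom l m) :
    InSk k (g.comp f) := by
  obtain ⟨j, hj, a, b, rfl⟩ := h
  exact ⟨j, hj, g.comp a, b, BoxHom.comp_assoc _ _ _⟩

theorem InSk.comp_right {l m n : ℕ} {k : ℤ} {f : BoxHom l m} (h : InSk k f) (g : BoxHom m n) :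
    InSk k (f.comp g) := by
  obtain ⟨j, hj, a, b, rfl⟩ := h
  exact ⟨j, hj, a, b.comp g, (BoxHom.comp_assoc _ _ _).symm⟩

theorem InSk.mono {m n : ℕ} {k l : ℤ} {f : BoxHom m n} (h : InSk k f) (hkl : k ≤ l) : InSk l f := by
  obtain ⟨j, hj, r⟩ := h
  exact ⟨j, hj.trans hkl, r⟩

theorem inSk_of_le {m n : ℕ} {k : ℤ} (f : BoxHom m n) (h : (n : ℤ) ≤ k) : InSk k f :=
  ⟨n, h, f, BoxHom.id n, BoxHom.comp_id f⟩

theorem inSk_of_comp_face {m n : ℕ} {k : ℤ} {f : BoxHom m n} {i : Fin (n + 1)} {ε : Bool}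
    (h : InSk k (f.comp (BoxHom.face i ε))) : InSk k f := by
  have := h.comp_right (BoxHom.degen i)
  rwa [BoxHom.comp_assoc, BoxHom.face_comp_degen, BoxHom.comp_id] at this

/-- Below dimension `n`, the skeleton of `□^(n+1)` is contained in any open box. -/
theorem InSk.exists_face {m n : ℕ} {k : ℤ} {f : BoxHom m (n + 1)} (h : InSk k f) (hk : k < n)
    (p : Fin (n + 1) × Bool) : ∃ q : Fin (n + 1) × Bool, q ≠ p ∧
      ∃ a : BoxHom m n, a.comp (BoxHom.face q.1 q.2) = f := by
  obtain ⟨l, hl, g, h, rfl⟩ := h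
  have hl' : l < n := by omega
  obtain ⟨i, ε, hi⟩ : ∃ (i : Fin n) (ε : Bool), h.coord (p.1.succAbove i) = Sum.inl ε := by
    by_contra hcon
    have hv : ∀ i : Fin n, ∃ a : Fin l, h.coord (p.1.succAbove i) = Sum.inr a := by
      intro i
      cases hc : h.coord (p.1.succAbove i) with
      | inl e => exact absurd ⟨i, e, hc⟩ hcon
      | inr a => exact ⟨a, rfl⟩
    choose v hv using hv
    have hinj : StrictMono v := fun i j hij =>
      h.strict _ _ _ _ (Fin.succAbove_lt_succAbove_iff.2 hij) (hv i) (hv j)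
    have := Fintype.card_le_of_injective v hinj.injective
    simp at this
    omega
  refine ⟨(p.1.succAbove i, ε), fun e => Fin.succAbove_ne p.1 i (congrArg Prod.fst e),
    g.comp (h.comp (BoxHom.degen (p.1.succAbove i))), ?_⟩
  rw [BoxHom.comp_assoc]
  exact congrArg _ (BoxHom.exists_factor h _ ε hi).symm

section Cubes

variable {X : FilCSet.{u}} {n : ℕ}

/-- The value of an `n`-cube of the successor on a cube of the `k`-skeleton of `□^n`. -/
def val (α : (dagger X).cube n) (k : ℤ) {m : ℕ} (f : BoxHom m n) (h : InSk k f) :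
    (X.obj k).cube m :=
  ((show sk.{u}.obj (std.{u} n) ⟶ X from α).app k).app (op (Box.mk m))
    ⟨stdCube f, mem_skeleton_std f h⟩

theorem val_res_left (α : (dagger X).cube n) (k : ℤ) {l m : ℕ} (g : BoxHom l m) (f : BoxHom m n)
    (h : InSk k f) : (X.obj k).res g (val α k f h) = val α k (g.comp f) (h.comp_left g) :=
  (onCube_res ((show sk.{u}.obj (std.{u} n) ⟶ X from α).app k) g
    ⟨stdCube f, mem_skeleton_std f h⟩).symm

theorem val_trans (α : (dagger X).cube n) {k l : ℤ} (hkl : k ≤ l) {m : ℕ} (f : BoxHom m n)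
    (h : InSk k f) : onCube (trans X hkl) (val α k f h) = val α l f (h.mono hkl) := by
  have := (show sk.{u}.obj (std.{u} n) ⟶ X from α).naturality (homOfLE hkl)
  exact (congrArg (fun t => onCube t
    (⟨stdCube f, mem_skeleton_std f h⟩ : cube ((std.{u} n).skeleton k).toFunctor m)) this).symm

theorem val_res (α : (dagger X).cube n) {l : ℕ} (g : BoxHom l n) (k : ℤ) {m : ℕ}
    (f : BoxHom m l) (h : InSk k f) :
    val ((dagger X).res g α) k f h = val α k (f.comp g) (h.comp_right g) := rfl

theorem dagger_ext {α β : (dagger X).cube n}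
    (H : ∀ (k : ℤ) (m : ℕ) (f : BoxHom m n) (h : InSk k f), val α k f h = val β k f h) :
    α = β := by
  refine NatTrans.ext (funext fun k => NatTrans.ext (funext fun U => ?_))
  ext x
  exact H k U.unop.dim x.1.down (inSk_of_mem (m := U.unop.dim) x.2)

/-- Construction of cubes of the successor. -/
noncomputable def mkCube (F : ∀ (k : ℤ) (m : ℕ) (f : BoxHom m n), InSk k f → (X.obj k).cube m)
    (h1 : ∀ (k : ℤ) (l m : ℕ) (g : BoxHom l m) (f : BoxHom m n) (h : InSk k f),
      (X.obj k).res g (F k m f h) = F k l (g.comp f) (h.comp_left g))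
    (h2 : ∀ (k l : ℤ) (hkl : k ≤ l) (m : ℕ) (f : BoxHom m n) (h : InSk k f),
      onCube (trans X hkl) (F k m f h) = F l m f (h.mono hkl)) : (dagger X).cube n :=
  show sk.{u}.obj (std.{u} n) ⟶ X from
  { app := fun k =>
      { app := fun U => TypeCat.ofHom fun x =>
          F k U.unop.dim x.1.down (inSk_of_mem (m := U.unop.dim) x.2)
        naturality := by
          intro U V g
          ext x
          exact (h1 k V.unop.dim U.unop.dim g.unop x.1.down
            (inSk_of_mem (m := U.unop.dim) x.2)).symm }
    naturality := by
      intro k l hkl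
      ext U x
      exact (h2 k l (leOfHom hkl) U.unop.dim x.1.down
        (inSk_of_mem (m := U.unop.dim) x.2)).symm }

theorem val_mkCube (F : ∀ (k : ℤ) (m : ℕ) (f : BoxHom m n), InSk k f → (X.obj k).cube m)
    (h1) (h2) (k : ℤ) {m : ℕ} (f : BoxHom m n) (h : InSk k f) :
    val (mkCube F h1 h2) k f h = F k m f h := rfl

end Cubes

/-- The map `X^0 → X^†` determined by the structure maps `X^0 → X^k`, `k ≥ 0`. -/
noncomputable def unit (X : FilCSet.{u}) : X.obj 0 ⟶ dagger X where
  app U := TypeCat.ofHom fun c =>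
    mkCube (X := X) (n := U.unop.dim)
      (fun _ _ f h => onCube (trans X h.nonneg) ((X.obj 0).res (n := U.unop.dim) f c))
      (fun k l m g f h => by rw [← onCube_res, res_res])
      (fun k l hkl m f h => trans_trans X _ _ _)
  naturality := by
    intro U V g
    ext c
    refine dagger_ext (n := V.unop.dim) fun k m f h => ?_
    exact congrArg (onCube (trans X h.nonneg))
      ((X.obj 0).res_res (m := V.unop.dim) (n := U.unop.dim) f g.unop c)

theorem val_unit (X : FilCSet.{u}) {n : ℕ} (c : (X.obj 0).cube n) (k : ℤ) {m : ℕ}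
    (f : BoxHom m n) (h : InSk k f) :
    val (onCube (unit X) c) k f h = onCube (trans X h.nonneg) ((X.obj 0).res f c) := rfl

/-- A filtered cubical set is fibrant if it is so levelwise. -/
class IsFibrant (X : FilCSet.{u}) : Prop where
  level : ∀ k : ℤ, CSet.IsFibrant (X.obj k)

instance (X : FilCSet.{u}) [hX : IsFibrant X] (k : ℤ) : CSet.IsFibrant (X.obj k) := hX.level k

/-- The successor of a fibrant filtered cubical set is fibrant. -/
instance (X : FilCSet.{u}) [IsFibrant X] : CSet.IsFibrant (dagger X) := by
  rw [CSet.isFibrant_iff]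
  intro n p y hy
  -- the compatible values of the given faces
  have hval : ∀ (k : ℤ) (m : ℕ) (q r : Fin (n + 1) × Bool) (_ : q ≠ p) (_ : r ≠ p)
      (a b : BoxHom m n) (ha : InSk k a) (hb : InSk k b),
      a.comp (BoxHom.face q.1 q.2) = b.comp (BoxHom.face r.1 r.2) →
      val (y q) k a ha = val (y r) k b hb := by
    intro k m q r hq hr a b ha hb hab
    obtain ⟨i, ε⟩ := q
    obtain ⟨j, η⟩ := r
    have key : ∀ (i j : Fin (n + 1)) (ε η : Bool) (_ : (i, ε) ≠ p) (_ : (j, η) ≠ p)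
        (a b : BoxHom m n) (ha : InSk k a) (hb : InSk k b), i < j →
        a.comp (BoxHom.face i ε) = b.comp (BoxHom.face j η) →
        val (y (i, ε)) k a ha = val (y (j, η)) k b hb := by
      intro i j ε η hq hr a b ha hb hij hab
      cases n with
      | zero => exact absurd hij (by omega)
      | succ n =>
        obtain ⟨i, j, hle, rfl, rfl⟩ := BoxHom.exists_castSucc_succ i j hij
        obtain ⟨c, rfl, rfl⟩ := BoxHom.exists_overlap hle hab
        have h0 := hy _ _ hq hr n (BoxHom.face j η) (BoxHom.face i ε)
          (BoxHom.face_comp_face i j hle ε η).symm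
        have hc := inSk_of_comp_face ha
        have h1 : val ((dagger X).res (BoxHom.face j η) (y (i.castSucc, ε))) k c hc =
            val ((dagger X).res (BoxHom.face i ε) (y (j.succ, η))) k c hc := by rw [h0]
        exact h1
    rcases lt_trichotomy i j with h | h | h
    · exact key i j ε η hq hr a b ha hb h hab
    · subst h
      obtain ⟨h1, rfl⟩ := BoxHom.eq_of_comp_face hab
      simp only at h1
      subst h1
      rfl
    · exact (key j i η ε hr hq b a hb ha h hab.symm).symm
  obtain ⟨z, hz⟩ := (CSet.isFibrant_iff (X.obj n)).1 inferInstance n p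
    (fun q => val (y q) n (BoxHom.id n) (inSk_of_le _ le_rfl)) (by
      intro q r hq hr k a b hab
      rw [val_res_left, val_res_left]
      exact hval _ _ _ _ hq hr _ _ _ _ hab)
  classical
  let F : ∀ (k : ℤ) (m : ℕ) (f : BoxHom m (n + 1)), InSk k f → (X.obj k).cube m := fun k m f h =>
    if hk : (n : ℤ) ≤ k then onCube (trans X hk) ((X.obj n).res f z)
    else
      have e := h.exists_face (not_le.1 hk) p
      val (y e.choose) k e.choose_spec.2.choose
        (inSk_of_comp_face (by rw [e.choose_spec.2.choose_spec]; exact h))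
  have hF : ∀ (k : ℤ) (m : ℕ) (q : Fin (n + 1) × Bool) (_ : q ≠ p) (a : BoxHom m n)
      (h : InSk k (a.comp (BoxHom.face q.1 q.2))),
      F k m _ h = val (y q) k a (inSk_of_comp_face h) := by
    intro k m q hq a h
    by_cases hk : (n : ℤ) ≤ k
    · simp only [F, dif_pos hk]
      rw [← res_res, hz q hq, val_res_left, val_trans]
      rfl
    · simp only [F, dif_neg hk]
      have e := h.exists_face (not_le.1 hk) p
      exact hval k m _ q e.choose_spec.1 hq _ a _ _ e.choose_spec.2.choose_spec
  have hF' : ∀ (k : ℤ) (hk : (n : ℤ) ≤ k) (m : ℕ) (f : BoxHom m (n + 1)) (h : InSk k f),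
      F k m f h = onCube (trans X hk) ((X.obj n).res f z) := by
    intro k hk m f h
    simp only [F, dif_pos hk]
  refine ⟨mkCube F ?_ ?_, fun q hq => dagger_ext fun k m f h => ?_⟩
  · intro k l m g f h
    by_cases hk : (n : ℤ) ≤ k
    · rw [hF' k hk _ _ h, hF' k hk _ _ (h.comp_left g), ← onCube_res, res_res]
    · obtain ⟨q, hq, a, rfl⟩ := h.exists_face (not_le.1 hk) p
      rw [hF k m q hq a h, val_res_left]
      have h' : InSk k ((g.comp a).comp (BoxHom.face q.1 q.2)) := by
        rw [BoxHom.comp_assoc]; exact h.comp_left g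
      refine (hF k l q hq (g.comp a) h').symm.trans ?_
      congr 1
      exact BoxHom.comp_assoc _ _ _
  · intro k l hkl m f h
    by_cases hk : (n : ℤ) ≤ k
    · rw [hF' k hk _ _ h, hF' l (hk.trans hkl) _ _ (h.mono hkl), onCube, onCube, trans_trans]
    · obtain ⟨q, hq, a, rfl⟩ := h.exists_face (not_le.1 hk) p
      rw [hF k m q hq a h, hF l m q hq a (h.mono hkl), val_trans]
  · rw [val_res, val_mkCube, hF k m q hq f (h.comp_right _)]

/-- The `m`-th component of an `m`-cube `sk(□^m) → X` of the successor, as an `m`-cube of `X^m`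
(the `m`-skeleton of `□^m` is `□^m`). -/
noncomputable def topCube (X : FilCSet.{u}) {m : ℕ} (α : (dagger X).cube m) :
    (X.obj m).cube m :=
  val α m (BoxHom.id m) (inSk_of_le _ le_rfl)

/-- The image in `X^k`, `k ≥ 0`, of a basepoint in `X^0`. -/
noncomputable def point (X : FilCSet.{u}) (x : (X.obj 0).cube 0) (k : ℕ) : (X.obj k).cube 0 :=
  onCube (trans X (Int.natCast_nonneg k)) x

theorem trans_point (X : FilCSet.{u}) (x : (X.obj 0).cube 0) {k l : ℕ} (h : (k : ℤ) ≤ l) :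
    onCube (trans X h) (point X x k) = point X x l := trans_trans X _ _ _

theorem val_const (X : FilCSet.{u}) (x : (X.obj 0).cube 0) {m n : ℕ} (k : ℕ) (f : BoxHom m n)
    (h : InSk (k : ℤ) f) :
    val ((dagger X).const (onCube (unit X) x) n) k f h = (X.obj k).const (point X x k) m := by
  rw [CSet.const, val_res, val_unit, onCube_res]
  exact congrArg (fun t => (X.obj k).res t (point X x k)) (BoxHom.toPoint_unique _)

/-- The structure map `X^k → X^(k+1)`, `k ≥ 0`. -/
noncomputable abbrev tau (X : FilCSet.{u}) (k : ℕ) : X.obj k ⟶ X.obj (k + 1 : ℕ) :=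
  trans X (Int.ofNat_le.2 k.le_succ)

theorem tau_point (X : FilCSet.{u}) (x : (X.obj 0).cube 0) (k : ℕ) :
    onCube (tau X k) (point X x k) = point X x (k + 1) := trans_point X x _

/-- An `m`-sphere of the successor at the image of `x` gives an `m`-sphere of `X^m`. -/
noncomputable def topSphere (X : FilCSet.{u}) (x : (X.obj 0).cube 0) {m : ℕ}
    (α : (dagger X).Sphere (onCube (unit X) x) m) : (X.obj m).Sphere (point X x m) m :=
  ⟨topCube X α.1, by
    rintro l f ⟨i, ε, hi⟩
    rw [topCube, val_res_left]
    cases m with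
    | zero => exact i.elim0
    | succ m =>
      have hf := BoxHom.exists_factor f i ε hi
      generalize f.comp (BoxHom.degen i) = g at hf
      subst hf
      have h2 : InSk ((m + 1 : ℕ) : ℤ) g := inSk_of_le _ (by simp)
      have h3 : val ((dagger X).res (BoxHom.face i ε) α.1) (m + 1 : ℕ) g h2 =
          val ((dagger X).const (onCube (unit X) x) m) (m + 1 : ℕ) g h2 := by
        rw [α.2 _ _ ⟨i, ε, BoxHom.face_coord_self i ε⟩]
      exact h3.trans (val_const X x _ g h2)⟩

theorem unit_naturality {X Y : FilCSet.{u}} (f : X ⟶ Y) (x : (X.obj 0).cube 0) :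
    onCube (daggerMap f) (onCube (unit X) x) = onCube (unit Y) (onCube (f.app 0) x) := by
  refine dagger_ext fun k m g h => ?_
  have := congrArg (fun t => onCube t ((X.obj 0).res g x)) (f.naturality (homOfLE h.nonneg))
  refine this.trans ?_
  exact congrArg (onCube (trans Y h.nonneg)) (onCube_res (f.app 0) g x)

theorem point_naturality {X Y : FilCSet.{u}} (f : X ⟶ Y) (x : (X.obj 0).cube 0) (k : ℕ) :
    onCube (f.app k) (point X x k) = point Y (onCube (f.app 0) x) k :=
  congrArg (fun t => onCube t x) (f.naturality (homOfLE (Int.natCast_nonneg k)))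

end FilCSet

/-! A map `sk(□^(n+1)) → X` is the same as its boundary together with one cube of `X^(n+1)`. The
`k`-skeleton of `□^(n+1)` lies in the boundary for `k ≤ n`, so below level `n+1` the faces determine
everything; from level `n+1` on the skeleton is all of `□^(n+1)`, so the component in `X^(n+1)`
determines everything. The only condition linking the two is that the faces of this top component be
the images under `X^n → X^(n+1)` of the top components of the faces (`res_face_topCube`).
`exists_cube_of_spheres` is the converse construction, for boundaries made of spheres at one vertex.

With all faces at the basepoint, this says that every `m`-sphere of `X^m` is the top component of an
`m`-sphere of `X^†` (`exists_topSphere_eq`). With two opposite faces `α`, `β` and the rest at the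
basepoint, it says that a homotopy from `α` to `β` in `X^†` amounts to a homotopy in `X^(m+1)`
between the images of their top components (`homotopic_iff_nextSphere`). Hence `π_m(X^†, x)` is the
set of spheres of `X^m` modulo homotopy in `X^(m+1)`, which is the image of `π_m(X^m)` in
`π_m(X^(m+1))`.

Fibrancy makes homotopy an equivalence relation, so that equal classes in `X^(m+1)` have homotopic
representatives; injectivity rests on this. Products are preserved since the top component of a
square is a square. For `π₀` the argument is the same, with edges in place of homotopies, and
vertices of `X^0` lift along `ι`. -/

/-! ### Constant coordinates of maps of cubes -/

namespace BoxHom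

/-- A map from a cube to a cube of larger dimension has a constant coordinate. -/
theorem exists_coord_eq_inl {l n : ℕ} (f : BoxHom l n) (h : l < n) :
    ∃ i ε, f.coord i = Sum.inl ε := by
  by_contra hcon
  have hv : ∀ i : Fin n, ∃ a : Fin l, f.coord i = Sum.inr a := by
    intro i
    cases hc : f.coord i with
    | inl e => exact absurd ⟨i, e, hc⟩ hcon
    | inr a => exact ⟨a, rfl⟩
  choose v hv using hv
  -- If no coordinate were constant, the variables used would embed `Fin n` into the smaller `Fin
  -- l`.
  have hinj : StrictMono v := fun i j hij => f.strict _ _ _ _ hij (hv i) (hv j)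
  have := Fintype.card_le_of_injective v hinj.injective
  simp only [Fintype.card_fin] at this
  omega

/-- A cube in the intersection of two nonparallel faces has a constant coordinate. -/
theorem exists_coord_eq_inl_of_comp_face {k n : ℕ} {i j : Fin (n + 1)} (hij : j ≠ i) {ε η : Bool}
    {a b : BoxHom k n} (hab : a.comp (face i ε) = b.comp (face j η)) :
    ∃ i' ε', a.coord i' = Sum.inl ε' := by
  obtain ⟨l, rfl⟩ := Fin.exists_succAbove_eq hij
  -- The coordinate `j` of the common composite is the constant `η`; since `j = i.succAbove l`, it
  -- is also the coordinate `l` of `a`.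
  exact ⟨l, η, by rw [← comp_face_succAbove a i ε l, hab, comp_face_self]⟩

end BoxHom

/-! ### Homotopies and edges as equivalence relations -/

namespace CSet

/-- The homotopy and the degenerate square on `a` agree on bottom, top and left faces, so by
`sq_congr` their right faces `b` and `a` are homotopic. -/
theorem Sphere.Homotopic.symm {K : CSet.{u}} [K.IsFibrant] {x : K.cube 0} {n : ℕ}
    {a b : K.Sphere x (n + 1)} (h : a.Homotopic b) : b.Homotopic a :=
  sq_congr 1 ((homotopic_iff_sq _ _).1 h) (sq_refl a) (Sphere.Homotopic.refl _)
    (fun _ => Sphere.Homotopic.refl _) (Sphere.Homotopic.refl _) (fun h => absurd h (by decide))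

theorem Sphere.Homotopic.trans {K : CSet.{u}} [K.IsFibrant] {x : K.cube 0} {n : ℕ}
    {a b c : K.Sphere x (n + 1)} (h : a.Homotopic b) (h' : b.Homotopic c) : a.Homotopic c :=
  -- The first homotopy is reversed so that both squares have the left face `b`; their right faces
  -- are `a` and `c`.
  sq_congr 1 ((homotopic_iff_sq _ _).1 h.symm) ((homotopic_iff_sq _ _).1 h')
    (Sphere.Homotopic.refl _) (fun _ => Sphere.Homotopic.refl _) (Sphere.Homotopic.refl _)
    (fun h => absurd h (by decide))

/-- Equality in the quotient is the equivalence relation generated by homotopy, and homotopy is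
already one in a fibrant cubical set. This is what turns an equality of classes into a cube. -/
theorem PiN.mk_eq_mk_iff {K : CSet.{u}} [K.IsFibrant] {x : K.cube 0} {n : ℕ}
    {a b : K.Sphere x (n + 1)} : PiN.mk a = PiN.mk b ↔ a.Homotopic b := by
  refine ⟨fun h => ?_, fun h => Quot.sound h⟩
  have := Quot.eqvGen_exact h
  clear h
  induction this with
  | rel _ _ h => exact h
  | refl => exact Sphere.Homotopic.refl _
  | symm _ _ _ ih => exact ih.symm
  | trans _ _ _ _ _ ih1 ih2 => exact ih1.trans ih2

/-- Two vertices are joined by an edge. -/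
def Joined (K : CSet.{u}) (a b : K.cube 0) : Prop :=
  ∃ e : K.cube 1, K.res (BoxHom.face 0 false) e = a ∧ K.res (BoxHom.face 0 true) e = b

theorem Joined.refl {K : CSet.{u}} (a : K.cube 0) : K.Joined a a :=
  ⟨K.res (BoxHom.degen 0) a, by rw [res_res, BoxHom.face_comp_degen, res_id],
    by rw [res_res, BoxHom.face_comp_degen, res_id]⟩

/-- The edge opposite to a degenerate one in a square with three given sides. -/
theorem Joined.of_common_source {K : CSet.{u}} [K.IsFibrant] {a b c : K.cube 0}
    (h : K.Joined a b) (h' : K.Joined a c) : K.Joined b c := by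
  obtain ⟨e, he0, he1⟩ := h
  obtain ⟨e', he0', he1'⟩ := h'
  obtain ⟨d, hd0, hd1⟩ := Joined.refl a
  -- `corner s t` is the vertex with coordinates `(s, t)` of a square whose side `s = 0` is
  -- degenerate at `a` and whose sides `t = 0`, `t = 1` are the given edges. The missing side `s =
  -- 1` runs from `b` to `c`.
  let corner : Bool → Bool → K.cube 0 := fun s t => if s then (if t then c else b) else a
  obtain ⟨z, -, hz⟩ := IsFibrant.exists_lid K (n := 0)
    (fun i ε _ η => if i = 0 then corner ε η else corner η ε)
    (by
      intro i j _ ε η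
      obtain rfl : i = 0 := Fin.fin_one_eq_zero i
      obtain rfl : j = 0 := Fin.fin_one_eq_zero j
      rfl)
    (0, true) (fun i ε => if i = 0 then d else if ε then e' else e)
    (by
      intro i ε hp j η
      obtain rfl : j = 0 := Fin.fin_one_eq_zero j
      fin_cases i <;> cases ε <;> cases η
      all_goals first
        | exact absurd rfl hp
        | assumption)
  exact ⟨_, hz 0 false, hz 0 true⟩

theorem Joined.symm {K : CSet.{u}} [K.IsFibrant] {a b : K.cube 0} (h : K.Joined a b) :
    K.Joined b a :=
  h.of_common_source (Joined.refl a)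

theorem PiZero.mk_eq_mk_iff {K : CSet.{u}} [K.IsFibrant] {a b : K.cube 0} :
    (Quot.mk _ a : PiZero K) = Quot.mk _ b ↔ K.Joined a b := by
  refine ⟨fun h => ?_, fun h => Quot.sound h⟩
  have := Quot.eqvGen_exact h
  clear h
  induction this with
  | rel _ _ h => exact h
  | refl => exact Joined.refl _
  | symm _ _ _ ih => exact ih.symm
  -- Reversing the first edge makes both start at the middle vertex.
  | trans _ _ _ _ _ ih1 ih2 => exact ih1.symm.of_common_source ih2

end CSet

/-! ### Cubes of the successor from their boundary and top component -/

namespace FilCSet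

open CSet

/-- The `n`-skeleton of `□^(n+1)` is contained in the boundary. -/
theorem InSk.exists_face_of_lt {m n : ℕ} {k : ℤ} {f : BoxHom m (n + 1)} (h : InSk k f)
    (hk : ¬ ((n + 1 : ℕ) : ℤ) ≤ k) : ∃ (q : Fin (n + 1) × Bool) (a : BoxHom m n),
      a.comp (BoxHom.face q.1 q.2) = f := by
  obtain ⟨l, hl, g, h, rfl⟩ := h
  obtain ⟨i, ε, hi⟩ := h.exists_coord_eq_inl (by omega)
  exact ⟨(i, ε), g.comp (h.comp (BoxHom.degen i)), by
    rw [BoxHom.comp_assoc, ← BoxHom.exists_factor h i ε hi]⟩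

section

variable {X : FilCSet.{u}}

theorem res_topCube {m n : ℕ} (w : (dagger X).cube n) (f : BoxHom m n) :
    (X.obj n).res f (topCube X w) = val w n f (inSk_of_le _ le_rfl) :=
  val_res_left _ _ _ _ _

/-- A face of `□^(n+1)` already lies in the `n`-skeleton, so compatibility with the filtration
forces its value in `X^(n+1)` to come from `X^n`. This is the source of the shift from `X^m` to
`X^(m+1)` in the theorem. -/
theorem res_face_topCube {n : ℕ} (w : (dagger X).cube (n + 1)) (i : Fin (n + 1)) (ε : Bool) :
    (X.obj (n + 1 : ℕ)).res (BoxHom.face i ε) (topCube X w) =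
      onCube (tau X n) (topCube X ((dagger X).res (BoxHom.face i ε) w)) := by
  rw [res_topCube, topCube, val_trans, val_res]
  congr 1
  exact (BoxHom.id_comp _).symm

/-- The values of a sphere of the successor on the boundary. -/
theorem val_sphere {n : ℕ} {x : (dagger X).cube 0} (α : (dagger X).Sphere x n) (k : ℤ) {m : ℕ}
    (f : BoxHom m n) (h : InSk k f) (hf : ∃ i ε, f.coord i = Sum.inl ε) :
    val α.1 k f h = val x k (BoxHom.toPoint m) (inSk_of_le _ h.nonneg) := by
  obtain ⟨i, ε, hi⟩ := hf
  cases n with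
  | zero => exact i.elim0
  | succ n =>
    have hf := BoxHom.exists_factor f i ε hi
    generalize f.comp (BoxHom.degen i) = g at hf
    subst hf
    -- A boundary cell factors through a face, where the sphere is the degenerate cube at `x`; its
    -- value there depends only on the projection to the point.
    have h1 : val ((dagger X).res (BoxHom.face i ε) α.1) k g (inSk_of_comp_face h) =
        val ((dagger X).const x n) k g (inSk_of_comp_face h) := by
      rw [α.2 _ _ ⟨i, ε, BoxHom.face_coord_self i ε⟩]
    refine h1.trans ?_
    rw [CSet.const, val_res]
    congr 1
    exact BoxHom.toPoint_unique _

/-- Spheres prescribing the boundary of an `(n+1)`-cube of the successor extend to an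
`(n+1)`-cube with a given top component. -/
theorem exists_cube_of_spheres {n : ℕ} {x : (dagger X).cube 0}
    (y : Fin (n + 1) → Bool → (dagger X).Sphere x n) (z : (X.obj (n + 1 : ℕ)).cube (n + 1))
    (hz : ∀ i ε, (X.obj (n + 1 : ℕ)).res (BoxHom.face i ε) z =
      onCube (tau X n) (topCube X (y i ε).1)) :
    ∃ w : (dagger X).cube (n + 1), (∀ i ε, (dagger X).res (BoxHom.face i ε) w = (y i ε).1) ∧
      topCube X w = z := by
  -- The values prescribed on a cell do not depend on the face containing it.
  have hval : ∀ (k : ℤ) (m : ℕ) (q r : Fin (n + 1) × Bool)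
      (a b : BoxHom m n) (ha : InSk k a) (hb : InSk k b),
      a.comp (BoxHom.face q.1 q.2) = b.comp (BoxHom.face r.1 r.2) →
      val (y q.1 q.2).1 k a ha = val (y r.1 r.2).1 k b hb := by
    rintro k m ⟨i, ε⟩ ⟨j, η⟩ a b ha hb hab
    simp only at hab ⊢
    by_cases hij : i = j
    · subst hij
      obtain ⟨rfl, rfl⟩ := BoxHom.eq_of_comp_face hab
      rfl
    -- A cell common to two nonparallel faces is in the boundary of each of them, where both spheres
    -- take the value of `x`. Here it matters that all the spheres have the same basepoint.
    · rw [val_sphere _ _ _ _ (BoxHom.exists_coord_eq_inl_of_comp_face (Ne.symm hij) hab),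
        val_sphere _ _ _ _ (BoxHom.exists_coord_eq_inl_of_comp_face hij hab.symm)]
  classical
  -- From level `n+1` on, values are restrictions of `z` pushed forward; below it, every cell lies
  -- in a face, and one is chosen.
  let F : ∀ (k : ℤ) (m : ℕ) (f : BoxHom m (n + 1)), InSk k f → (X.obj k).cube m := fun k m f h =>
    if hk : ((n + 1 : ℕ) : ℤ) ≤ k then onCube (trans X hk) ((X.obj (n + 1 : ℕ)).res f z)
    else
      have e := h.exists_face_of_lt hk
      val (y e.choose.1 e.choose.2).1 k e.choose_spec.choose
        (inSk_of_comp_face (by rw [e.choose_spec.choose_spec]; exact h))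
  have hF : ∀ (k : ℤ) (m : ℕ) (q : Fin (n + 1) × Bool) (a : BoxHom m n)
      (h : InSk k (a.comp (BoxHom.face q.1 q.2))),
      F k m _ h = val (y q.1 q.2).1 k a (inSk_of_comp_face h) := by
    intro k m q a h
    by_cases hk : ((n + 1 : ℕ) : ℤ) ≤ k
    · simp only [F, dif_pos hk]
      -- At levels where `F` is given by `z`, agreement with the prescribed faces is exactly the
      -- hypothesis `hz`.
      rw [← res_res, hz q.1 q.2, ← onCube_res, res_topCube, val_trans, val_trans]
    · simp only [F, dif_neg hk]
      have e := h.exists_face_of_lt hk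
      exact hval k m _ q _ a _ _ e.choose_spec.choose_spec
  have hF' : ∀ (k : ℤ) (hk : ((n + 1 : ℕ) : ℤ) ≤ k) (m : ℕ) (f : BoxHom m (n + 1)) (h : InSk k f),
      F k m f h = onCube (trans X hk) ((X.obj (n + 1 : ℕ)).res f z) := by
    intro k hk m f h
    simp only [F, dif_pos hk]
  refine ⟨mkCube F ?_ ?_, fun i ε => dagger_ext fun k m f h => ?_, ?_⟩
  · intro k l m g f h
    by_cases hk : ((n + 1 : ℕ) : ℤ) ≤ k
    · rw [hF' k hk _ _ h, hF' k hk _ _ (h.comp_left g), ← onCube_res, res_res]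
    · obtain ⟨q, a, rfl⟩ := h.exists_face_of_lt hk
      rw [hF k m q a h, val_res_left]
      have h' : InSk k ((g.comp a).comp (BoxHom.face q.1 q.2)) := by
        rw [BoxHom.comp_assoc]; exact h.comp_left g
      refine (hF k l q (g.comp a) h').symm.trans ?_
      congr 1
      exact BoxHom.comp_assoc _ _ _
  · intro k l hkl m f h
    by_cases hk : ((n + 1 : ℕ) : ℤ) ≤ k
    · rw [hF' k hk _ _ h, hF' l (hk.trans hkl) _ _ (h.mono hkl), onCube, onCube, trans_trans]
    · obtain ⟨q, a, rfl⟩ := h.exists_face_of_lt hk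
      -- `hF` holds at every level, so the passage from `k` below `n+1` to `l` above it needs no
      -- separate case.
      rw [hF k m q a h, hF l m q a (h.mono hkl), val_trans]
  · rw [val_res, val_mkCube, hF k m (i, ε) f (h.comp_right _)]
  · rw [topCube, val_mkCube, hF' _ le_rfl _ _ (inSk_of_le _ le_rfl), res_id]
    exact trans_self X _ _

end

/-! ### Homotopy groups of the successor -/

section Pi

variable (X : FilCSet.{u}) (x : (X.obj 0).cube 0)

theorem topCube_const (n : ℕ) :
    topCube X ((dagger X).const (onCube (unit X) x) n) = (X.obj n).const (point X x n) n :=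
  val_const X x n _ _

/-- The image in `X^(n+1)` of an `n`-sphere of the successor. -/
noncomputable def nextSphere {n : ℕ} (α : (dagger X).Sphere (onCube (unit X) x) n) :
    (X.obj (n + 1 : ℕ)).Sphere (point X x (n + 1)) n :=
  (topSphere X x α).map (tau X n) (tau_point X x n)

variable {X x}

/-- When all faces are at the basepoint, the condition on the top component says just that it is a
sphere, so any sphere may be prescribed. -/
theorem exists_topSphere_eq {n : ℕ} (a : (X.obj (n + 1 : ℕ)).Sphere (point X x (n + 1)) (n + 1)) :
    ∃ α : (dagger X).Sphere (onCube (unit X) x) (n + 1), topSphere X x α = a := by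
  obtain ⟨w, h1, h2⟩ := exists_cube_of_spheres
    (fun _ _ => Sphere.one (dagger X) (onCube (unit X) x) n) a.1 (fun i ε => by
      rw [a.res_face, Sphere.one, topCube_const, onCube_const, tau_point])
  exact ⟨⟨w, (Sphere.isSphere_iff _).2 h1⟩, Subtype.ext h2⟩

/-- The top component of a homotopy is a homotopy in `X^(n+1)`, and conversely one there supplies
the only datum of a homotopy in the successor not fixed by its boundary. One direction makes the map
on `π_n` well defined, the other gives its injectivity. -/
theorem homotopic_iff_nextSphere {n : ℕ} {α β : (dagger X).Sphere (onCube (unit X) x) n} :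
    α.Homotopic β ↔ (nextSphere X x α).Homotopic (nextSphere X x β) := by
  constructor
  · rintro ⟨H, h1, h2, h3⟩
    refine ⟨topCube X H, ?_, ?_, fun i ε hi => ?_⟩
    · rw [res_face_topCube, h1]; rfl
    · rw [res_face_topCube, h2]; rfl
    · rw [res_face_topCube, h3 i ε hi, topCube_const, onCube_const, tau_point]
  · rintro ⟨H, h1, h2, h3⟩
    -- `H` serves as top component; the faces are `α`, `β` in the first direction and the constant
    -- sphere elsewhere.
    obtain ⟨w, hw, -⟩ := exists_cube_of_spheres
      (fun i ε => if i = 0 then (if ε then β else α) else Sphere.one _ _ n) H (fun i ε => by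
        by_cases hi : i = 0
        · subst hi
          cases ε
          · exact h1
          · exact h2
        · rw [if_neg hi, h3 i ε hi, Sphere.one, topCube_const, onCube_const, tau_point])
    exact ⟨w, hw 0 false, hw 0 true, fun i ε hi => by rw [hw, if_neg hi]; rfl⟩

/-- Top components of squares are squares, by `res_face_topCube`; this yields multiplicativity. -/
theorem sq_nextSphere {n : ℕ} {a b c d : (dagger X).Sphere (onCube (unit X) x) (n + 1)}
    (h : Sq a b c d) : Sq (nextSphere X x a) (nextSphere X x b)
      (nextSphere X x c) (nextSphere X x d) := by
  obtain ⟨σ, hσ⟩ := h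
  refine ⟨topCube X σ, fun i ε => ?_⟩
  rw [res_face_topCube, hσ]
  induction i using Fin.cases with
  | zero => cases ε <;> rfl
  | succ i =>
    induction i using Fin.cases with
    | zero => cases ε <;> rfl
    | succ i =>
      show onCube _ (topCube X ((dagger X).const _ _)) = (X.obj _).const _ _
      rw [topCube_const, onCube_const, tau_point]

theorem nextSphere_one (n : ℕ) :
    nextSphere X x (Sphere.one _ _ n) = Sphere.one _ _ n :=
  Subtype.ext (by
    show onCube _ (topCube X ((dagger X).const _ _)) = (X.obj _).const _ _
    rw [topCube_const, onCube_const, tau_point])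

variable (X x)

/-- The homomorphism `π_(n+1)(X^†) → π_(n+1)(X^(n+2))` induced by taking top components. -/
noncomputable def nextHom [IsFibrant X] (n : ℕ) :
    PiN (n + 1) (dagger X) (onCube (unit X) x) →*
      PiN (n + 1) (X.obj (n + 1 + 1 : ℕ)) (point X x (n + 1 + 1)) :=
  MonoidHom.mk' (Quot.map (nextSphere X x) fun _ _ => homotopic_iff_nextSphere.1) (by
    intro a b
    induction a using Quot.ind with
    | mk a =>
    induction b using Quot.ind with
    | mk b =>
      -- Any square witnesses a product, so it suffices to take the top component of the square
      -- defining `a.mul b`.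
      refine (PiN.mul_eq_of_sq (a := nextSphere X x a) (b := nextSphere X x b)
        (c := nextSphere X x (a.mul b)) ?_).symm
      have := sq_nextSphere (Sphere.mul_sq a b)
      rwa [nextSphere_one] at this)

theorem nextHom_injective [IsFibrant X] (n : ℕ) : Function.Injective (nextHom X x n) := by
  intro a b h
  induction a using Quot.ind with
  | mk a =>
  induction b using Quot.ind with
  | mk b =>
    exact Quot.sound (homotopic_iff_nextSphere.2 (PiN.mk_eq_mk_iff.1 h))

/-- Each `nextSphere` is by construction the image of a sphere of `X^(n+1)`, and by
`exists_topSphere_eq` every sphere of `X^(n+1)` arises. The lift to `π_(n+1)(X^(n+1))` is chosen on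
representatives only: a homotopy in the successor relates top spheres only after passing to
`X^(n+2)`. -/
theorem range_nextHom [IsFibrant X] (n : ℕ) :
    (nextHom X x n).range =
      (PiN.mapHom (n := n) (tau X (n + 1)) (tau_point X x (n + 1))).range := by
  ext c
  constructor
  · rintro ⟨a, rfl⟩
    induction a using Quot.ind with
    | mk a => exact ⟨PiN.mk (topSphere X x a), rfl⟩
  · rintro ⟨a, rfl⟩
    induction a using Quot.ind with
    | mk a =>
      obtain ⟨α, rfl⟩ := exists_topSphere_eq a
      exact ⟨PiN.mk α, rfl⟩

/-- The homotopy groups of the successor. -/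
noncomputable def piEquiv [IsFibrant X] (n : ℕ) :
    PiN (n + 1) (dagger X) (onCube (unit X) x) ≃*
      (PiN.mapHom (n := n) (tau X (n + 1)) (tau_point X x (n + 1))).range :=
  (MonoidHom.ofInjective (nextHom_injective X x n)).trans
    (MulEquiv.subgroupCongr (range_nextHom X x n))

end Pi

/-! ### Components of the successor -/

section PiZero

variable (X : FilCSet.{u})

/-- The vertex of `X^0` given by a vertex of the successor. -/
noncomputable def bottomVertex (α : (dagger X).cube 0) : (X.obj 0).cube 0 :=
  val α 0 (BoxHom.id 0) (inSk_of_le _ le_rfl)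

theorem bottomVertex_unit (x : (X.obj 0).cube 0) : bottomVertex X (onCube (unit X) x) = x := by
  rw [bottomVertex, val_unit, res_id]
  exact trans_self X _ _

/-- The analogue of `homotopic_iff_nextSphere` for edges: an edge of the successor is a pair of
vertices with an edge of `X^1` joining their images. -/
theorem joined_iff_bottomVertex {α β : (dagger X).cube 0} :
    (dagger X).Joined α β ↔ (X.obj 1).Joined (onCube (trans X zero_le_one) (bottomVertex X α))
      (onCube (trans X zero_le_one) (bottomVertex X β)) := by
  constructor
  · rintro ⟨w, rfl, rfl⟩
    exact ⟨topCube X w, res_face_topCube w 0 false, res_face_topCube w 0 true⟩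
  · rintro ⟨z, h1, h2⟩
    -- Every vertex is a `0`-sphere, whatever the basepoint, because `□^0` has no coordinates; so
    -- the basepoint `α` is an arbitrary choice.
    obtain ⟨w, hw, -⟩ := exists_cube_of_spheres (n := 0) (x := α)
      (fun _ ε => if ε then ⟨β, fun _ _ h => h.choose.elim0⟩ else ⟨α, fun _ _ h => h.choose.elim0⟩)
      z (fun i ε => by
        obtain rfl : i = 0 := Fin.fin_one_eq_zero i
        cases ε
        · exact h1
        · exact h2)
    exact ⟨w, hw 0 false, hw 0 true⟩

/-- The map `π₀(X^†) → π₀(X^1)` induced by taking bottom vertices. -/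
noncomputable def piZeroMap : PiZero (dagger X) → PiZero (X.obj 1) :=
  Quot.map (fun α => onCube (trans X zero_le_one) (bottomVertex X α))
    fun _ _ => (joined_iff_bottomVertex X).1

theorem piZeroMap_unit (a : PiZero (X.obj 0)) :
    piZeroMap X (PiZero.map (unit X) a) =
      PiZero.map (trans X (k := 0) (l := 1) zero_le_one) a := by
  induction a using Quot.ind with
  | mk a =>
    exact congrArg (fun t => (Quot.mk _ (onCube (trans X zero_le_one) t) : PiZero (X.obj 1)))
      (bottomVertex_unit X a)

theorem piZeroMap_injective [IsFibrant X] : Function.Injective (piZeroMap X) := by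
  intro a b h
  induction a using Quot.ind with
  | mk a =>
  induction b using Quot.ind with
  | mk b => exact Quot.sound ((joined_iff_bottomVertex X).2 (PiZero.mk_eq_mk_iff.1 h))

/-- Classes in the range are represented by images of bottom vertices, and every vertex of `X^0` is
the bottom vertex of its image under `ι`. -/
theorem range_piZeroMap : Set.range (piZeroMap X) =
    Set.range (PiZero.map (trans X (k := 0) (l := 1) zero_le_one)) := by
  ext c
  constructor
  · rintro ⟨a, rfl⟩
    induction a using Quot.ind with
    | mk a => exact ⟨Quot.mk _ (bottomVertex X a), rfl⟩
  · rintro ⟨a, rfl⟩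
    exact ⟨_, piZeroMap_unit X a⟩

/-- The set of components of the successor. -/
noncomputable def piZeroEquiv [IsFibrant X] : PiZero (dagger X) ≃
    Set.range (PiZero.map (trans X (k := 0) (l := 1) zero_le_one)) :=
  (Equiv.ofInjective _ (piZeroMap_injective X)).trans (Equiv.setCongr (range_piZeroMap X))

end PiZero

/-! ### Naturality and the main theorem -/

theorem trans_naturality {X Y : FilCSet.{u}} (f : X ⟶ Y) {k l : ℤ} (h : k ≤ l) {n : ℕ}
    (c : (X.obj k).cube n) :
    onCube (f.app l) (onCube (trans X h) c) = onCube (trans Y h) (onCube (f.app k) c) :=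
  congrArg (fun t => onCube t c) (f.naturality (homOfLE h))

end FilCSet

theorem mainTheorem3 :
    -- the isomorphism on `π₀`
    (∃ e : ∀ (X : FilCSet.{u}) [FilCSet.IsFibrant X],
        CSet.PiZero (FilCSet.dagger X) ≃
          Set.range (CSet.PiZero.map (FilCSet.trans X (k := 0) (l := 1) zero_le_one)),
      -- it is induced by the map from `X^0` to the successor
      (∀ (X : FilCSet.{u}) [FilCSet.IsFibrant X] (a : CSet.PiZero (X.obj 0)),
        (e X (CSet.PiZero.map (FilCSet.unit X) a) : CSet.PiZero (X.obj 1)) =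
          CSet.PiZero.map (FilCSet.trans X (k := 0) (l := 1) zero_le_one) a) ∧
      -- it is natural
      (∀ (X Y : FilCSet.{u}) [FilCSet.IsFibrant X] [FilCSet.IsFibrant Y] (f : X ⟶ Y)
        (a : CSet.PiZero (FilCSet.dagger X)),
        (e Y (CSet.PiZero.map (FilCSet.daggerMap f) a) : CSet.PiZero (Y.obj 1)) =
          CSet.PiZero.map (f.app 1) (e X a))) ∧
    -- the group isomorphisms on `π_m`, `m = n + 1`
    (∃ e : ∀ (X : FilCSet.{u}) [FilCSet.IsFibrant X] (x : (X.obj 0).cube 0) (n : ℕ),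
        CSet.PiN (n + 1) (FilCSet.dagger X) (CSet.onCube (FilCSet.unit X) x) ≃*
          (CSet.PiN.mapHom (n := n) (FilCSet.tau X (n + 1))
            (FilCSet.tau_point X x (n + 1))).range,
      -- it takes the class of a map `sk(□^m) → X` to the image in `π_m(X^(m+1))` of the class of
      -- its `m`-th component `□^m → X^m`
      (∀ (X : FilCSet.{u}) [FilCSet.IsFibrant X] (x : (X.obj 0).cube 0) (n : ℕ)
        (α : (FilCSet.dagger X).Sphere (CSet.onCube (FilCSet.unit X) x) (n + 1)),
        (e X x n (CSet.PiN.mk α) :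
            CSet.PiN (n + 1) (X.obj (n + 1 + 1 : ℕ)) (FilCSet.point X x (n + 1 + 1))) =
          CSet.PiN.map (FilCSet.tau X (n + 1)) (FilCSet.tau_point X x (n + 1))
            (CSet.PiN.mk (FilCSet.topSphere X x α))) ∧
      -- it is compatible with the map from `X^0` to the successor
      (∀ (X : FilCSet.{u}) [FilCSet.IsFibrant X] (x : (X.obj 0).cube 0) (n : ℕ)
        (a : CSet.PiN (n + 1) (X.obj 0) x),
        (e X x n (CSet.PiN.map (FilCSet.unit X) rfl a) :
            CSet.PiN (n + 1) (X.obj (n + 1 + 1 : ℕ)) (FilCSet.point X x (n + 1 + 1))) =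
          CSet.PiN.map (FilCSet.trans X (Int.natCast_nonneg (n + 1 + 1))) rfl a) ∧
      -- it is natural
      (∀ (X Y : FilCSet.{u}) [FilCSet.IsFibrant X] [FilCSet.IsFibrant Y] (f : X ⟶ Y)
        (x : (X.obj 0).cube 0) (n : ℕ)
        (a : CSet.PiN (n + 1) (FilCSet.dagger X) (CSet.onCube (FilCSet.unit X) x)),
        (e Y (CSet.onCube (f.app 0) x) n
            (CSet.PiN.map (FilCSet.daggerMap f) (FilCSet.unit_naturality f x) a) :
            CSet.PiN (n + 1) (Y.obj (n + 1 + 1 : ℕ))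
              (FilCSet.point Y (CSet.onCube (f.app 0) x) (n + 1 + 1))) =
          CSet.PiN.map (f.app (n + 1 + 1 : ℕ)) (FilCSet.point_naturality f x (n + 1 + 1))
            (e X x n a).1)) := by
  refine ⟨⟨fun X _ => FilCSet.piZeroEquiv X, fun X _ a => FilCSet.piZeroMap_unit X a,
    fun X Y _ _ f a => ?_⟩, ⟨fun X _ x n => FilCSet.piEquiv X x n, fun X _ x n α => rfl,
    fun X _ x n a => ?_, fun X Y _ _ f x n a => ?_⟩⟩
  · induction a using Quot.ind with
    | mk a => exact congrArg (Quot.mk _) (FilCSet.trans_naturality f zero_le_one _).symm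
  · induction a using Quot.ind with
    | mk a =>
      refine congrArg CSet.PiN.mk (Subtype.ext ?_)
      show CSet.onCube (FilCSet.tau X (n + 1)) (FilCSet.topCube X (CSet.onCube _ a.1)) =
        CSet.onCube _ a.1
      -- The top component of `ι(a)` is the image of `a` in `X^(n+1)`; the two structure maps then
      -- compose to `X^0 → X^(n+2)`.
      rw [FilCSet.topCube, FilCSet.val_unit, CSet.res_id]
      exact FilCSet.trans_trans X _ _ _
  · induction a using Quot.ind with
    | mk a =>
      -- The successor of `f` acts by composition, so it applies `f` to top components, and `f`
      -- commutes with the structure maps.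
      exact congrArg CSet.PiN.mk (Subtype.ext (FilCSet.trans_naturality f _ _).symm)
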